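/- Let $n\ge 1$ and let $K$ be a field. The Stasheff group $Sta_n$ is the group with generators $x_{ij}$ for $1\le i<j\le n$ and relations (1) $[x_{ij},x_{jk}]=x_{ik}$ for $i<j<k$, where $[a,b]:=b^{-1}aba^{-1}$; (2) $[x_{ij},x_{k\ell}]=1$ if $i,j,k,\ell$ are distinct and the open intervals $(i,j)$ and $(k,\ell)$ are either disjoint or one is contained in the other. Let $Q$ be a simply laced Dynkin quiver with $m$ vertices. For a positive root $\alpha$ of $Q$ let $M_\alpha$ be the indecomposable representation of $Q$ over $K$ with dimension vector $\alpha$, and let $P_i$ be the indecomposable projective representation at the vertex $i$. Let $\Sigma(Q)$ be the simplicial complex whose vertices are the indecomposable objects of the cluster category, namely the $M_\alpha$ and the shifted projectives $P_i[1]$, and whose simplices (the empty one included) are the sets of pairwise $\mathrm{Ext}$-orthogonal objects, where $\mathrm{Ext}^1(P_i[1],M)=\mathrm{Hom}(P_i,M)$ and the $P_i[1]$ are mutually $\mathrm{Ext}$-orthogonal. Its simplices with $m$ vertices are the cluster-tilting objects. Placing every vertex at its $g$-vector in $\mathbb R^m$ (the $g$-vector of $M$ is $\underline{\dim}\, P/\mathrm{rad}\,P-\underline{\dim}\,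 P'/\mathrm{rad}\,P'$ for a projective resolution $0\to P'\to P\to M\to 0$, and that of $P_i[1]$ is $-e_i$) realizes $\Sigma(Q)$ as a triangulation of $S^{m-1}$, and every simplex with $m-1$ vertices lies in a unique domain $$D(M_\alpha)=\{g\in\mathbb R^m : g\cdot\underline{\dim}\,M_\alpha=0,\ g\cdot\underline{\dim}\,M'\le 0\ \text{for all } M'\subseteq M_\alpha\}.$$ In the dual complex $D\Sigma(Q)$, the vertices are the cluster-tilting objects; the edge dual to a simplex with $m-1$ vertices lying in $D(M_\alpha)$ joins the two cluster-tilting objects containing that simplex, is labelled $\alpha$, and is oriented in the direction of $\alpha$; and the $2$-dimensional face dual to a simplex $\rho$ with $m-2$ vertices is the polygon whose vertices are the cluster-tilting objects containing $\rho$. The picture group of $Q$ is the group with one generator $x_\alpha$ for every positive root $\alpha$ of $Q$ and, for every $2$-dimensional face of $D\Sigma(Q)$, the relation that the product of the letters $x_\alpha^{\pm1}$ read along the boundary of that face is $1$, the exponent being $+1$ or $-1$ according to whether the edge is traversed along or against its orientation. Then the Stasheff group $Sta_n$ is isomorphic to the picture group of the quiver $A_{n-1}$ with straight orientation $1\leftarrow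 2\leftarrow\cdots\leftarrow n-1$. -/

import Mathlib

universe u

/-! ### The Stasheff group -/

/-- The commutator convention `[a, b] = b⁻¹ a b a⁻¹`, so that `[a, b] = c` means `a b = b c a`. -/
def stasheffComm {G : Type*} [Group G] (a b : G) : G := b⁻¹ * a * b * a⁻¹

/-- Indices `(i, j)` with `i < j` of the generators `x_{ij}` (with `{1, …, n}` replaced by
`Fin n`). -/
abbrev StasheffGen (n : ℕ) : Type := {p : Fin n × Fin n // p.1 < p.2}

/-- The free generator `x_{ij}`. -/
def stasheffX {n : ℕ} (i j : Fin n) (h : i < j) : FreeGroup (StasheffGen n) :=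
  FreeGroup.of ⟨(i, j), h⟩

/-- The open interval `(i, j)` of the real line with endpoints `i`, `j`. -/
def openInterval {n : ℕ} (i j : Fin n) : Set ℝ := Set.Ioo ((i : ℕ) : ℝ) ((j : ℕ) : ℝ)

/-- The relators of the Stasheff group. -/
inductive StasheffRel (n : ℕ) : FreeGroup (StasheffGen n) → Prop
  | comm (i j k : Fin n) (hij : i < j) (hjk : j < k) :
      StasheffRel n (stasheffComm (stasheffX i j hij) (stasheffX j k hjk) *
        (stasheffX i k (hij.trans hjk))⁻¹)
  | commute (i j k l : Fin n) (hij : i < j) (hkl : k < l)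
      (hdist : i ≠ k ∧ i ≠ l ∧ j ≠ k ∧ j ≠ l)
      (hint : Disjoint (openInterval i j) (openInterval k l) ∨
        openInterval i j ⊆ openInterval k l ∨ openInterval k l ⊆ openInterval i j) :
      StasheffRel n (stasheffComm (stasheffX i j hij) (stasheffX k l hkl))

/-- The Stasheff group `Sta_n`. -/
abbrev StasheffGroup (n : ℕ) : Type := PresentedGroup {r | StasheffRel n r}

/-! ### Representations of quivers -/

/-- A representation over `K` of the quiver `V` (equivalently, a module over the path algebra). -/
structure QuiverRep (K : Type u) [Field K] (V : Type) [Quiver.{0} V] where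
  space : V → Type u
  [addCommGroup : ∀ i, AddCommGroup (space i)]
  [module : ∀ i, Module K (space i)]
  map : ∀ {i j : V}, (i ⟶ j) → space i →ₗ[K] space j

attribute [instance] QuiverRep.addCommGroup QuiverRep.module

namespace QuiverRep

variable {K : Type u} [Field K] {V : Type} [Quiver.{0} V]

/-- Morphisms of representations. -/
structure Hom (M N : QuiverRep K V) where
  app : ∀ i, M.space i →ₗ[K] N.space i
  comm : ∀ {i j : V} (a : i ⟶ j) (x : M.space i), app j (M.map a x) = N.map a (app i x)

/-- Subrepresentations. -/
structure Sub (M : QuiverRep K V) where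
  carrier : ∀ i, Submodule K (M.space i)
  map_mem : ∀ {i j : V} (a : i ⟶ j) (x : M.space i), x ∈ carrier i → M.map a x ∈ carrier j

/-- A representation is indecomposable if it is nonzero and is not the direct sum of two nonzero
subrepresentations. -/
def IsIndecomposable (M : QuiverRep K V) : Prop :=
  (∃ i, Nontrivial (M.space i)) ∧
    ∀ A B : M.Sub, (∀ i, IsCompl (A.carrier i) (B.carrier i)) →
      (∀ i, A.carrier i = ⊥) ∨ (∀ i, B.carrier i = ⊥)

/-- `M` is (a copy of) `M_α`: a finite dimensional indecomposable representation with dimension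
vector `α`. -/
def IsIndecWithDim (M : QuiverRep K V) (α : V → ℕ) : Prop :=
  M.IsIndecomposable ∧ ∀ i, Module.Finite K (M.space i) ∧ Module.finrank K (M.space i) = α i

/-- `Hom(M, N) = 0`. -/
def HomVanishes (M N : QuiverRep K V) : Prop :=
  ∀ f : Hom M N, ∀ i x, f.app i x = 0

/-- `Ext¹(M, N) = 0`: every short exact sequence `0 → N → E → M → 0` splits. -/
def ExtVanishes (M N : QuiverRep K V) : Prop :=
  ∀ (E : QuiverRep K V) (f : Hom N E) (g : Hom E M),
    (∀ i, Function.Injective (f.app i)) → (∀ i, Function.Surjective (g.app i)) →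
    (∀ i, LinearMap.range (f.app i) = LinearMap.ker (g.app i)) →
    ∃ s : Hom M E, ∀ i x, g.app i (s.app i x) = x

/-- The indecomposable projective representation `P_i`: the space at `j` has the paths from `i`
to `j` as a basis, and arrows act by concatenation. -/
noncomputable def proj (K : Type u) [Field K] {V : Type} [Quiver.{0} V] (i : V) :
    QuiverRep K V where
  space j := Quiver.Path i j →₀ K
  map a := Finsupp.lmapDomain K K (fun p => p.cons a)

/-- The semi-invariant domain
`D(M) = {g ∈ ℝⁿ | g · dim M = 0 and g · dim M' ≤ 0 for all M' ⊆ M}`. -/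
def domain [Fintype V] (M : QuiverRep K V) : Set (V → ℝ) :=
  {g | ∑ i, g i * (Module.finrank K (M.space i) : ℝ) = 0 ∧
    ∀ A : M.Sub, ∑ i, g i * (Module.finrank K (A.carrier i) : ℝ) ≤ 0}

end QuiverRep

/-! ### Roots, the cluster complex `Σ(Q)`, and its dual -/

section Picture

variable (K : Type u) [Field K] (V : Type) [Quiver.{0} V] [Fintype V] [DecidableEq V]
  [∀ i j : V, Fintype (i ⟶ j)]

/-- The positive roots of a (simply laced) Dynkin quiver: the vectors `α` with nonnegative integer
coordinates on which the Tits form `∑ αᵢ² - ∑_{a : i → j} αᵢ αⱼ` takes the value `1`. -/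
abbrev PosRoot : Type :=
  {α : V → ℕ //
    ∑ i, (α i : ℤ) ^ 2 - ∑ i, ∑ j, (Fintype.card (i ⟶ j) : ℤ) * (α i : ℤ) * (α j : ℤ) = 1}

/-- Indecomposable objects of the cluster category: `M_α` for a positive root `α` (`Sum.inl α`),
and the shifted projectives `P_i[1]` for a vertex `i` (`Sum.inr i`). -/
abbrev ClusterIndec : Type := PosRoot V ⊕ V

variable {V}

/-- The `g`-vector. That of `M_α` has `j`-th coordinate `α_j - ∑_{a : i → j} α_i`, by the standard
projective resolution `0 → ⨁_{a : i → j} P_j ⊗ M_i → ⨁_i P_i ⊗ M_i → M → 0`; that of `P_i[1]` is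
`-e_i`. -/
def gVector : ClusterIndec V → V → ℝ
  | Sum.inl α => fun j => (α.1 j : ℝ) - ∑ i, (Fintype.card (i ⟶ j) : ℝ) * (α.1 i : ℝ)
  | Sum.inr i => fun j => if j = i then -1 else 0

/-- Ext-orthogonality of indecomposable objects in the cluster category, where
`Ext¹(P_i[1], M) = Hom(P_i, M)`. -/
def ExtOrthogonal : ClusterIndec V → ClusterIndec V → Prop
  | Sum.inl α, Sum.inl β => ∃ M N : QuiverRep K V, M.IsIndecWithDim α.1 ∧ N.IsIndecWithDim β.1 ∧
      M.ExtVanishes N ∧ N.ExtVanishes M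
  | Sum.inl α, Sum.inr i => ∃ M : QuiverRep K V, M.IsIndecWithDim α.1 ∧
      (QuiverRep.proj K i).HomVanishes M
  | Sum.inr i, Sum.inl α => ∃ M : QuiverRep K V, M.IsIndecWithDim α.1 ∧
      (QuiverRep.proj K i).HomVanishes M
  | Sum.inr _, Sum.inr _ => True

/-- The simplices of `Σ(Q)` (the empty one included), given by their sets of vertices. -/
def IsSimplex (ρ : Finset (ClusterIndec V)) : Prop :=
  ∀ u ∈ ρ, ∀ v ∈ ρ, ExtOrthogonal K u v

/-- The top dimensional simplices of `Σ(Q)`, that is, the cluster-tilting objects. They are the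
vertices of the dual complex. -/
def IsCluster (T : Finset (ClusterIndec V)) : Prop :=
  IsSimplex K T ∧ T.card = Fintype.card V

/-- `(α, ε)` labels the edge of the dual complex from the cluster `T` to the cluster `T'`: these
share a codimension one face, which lies in the wall `D(M_α)`, and the passage from `T` to `T'`
crosses this wall in the direction of `α` (if `ε = true`) or of `-α` (if `ε = false`). -/
def DualEdge (T T' : Finset (ClusterIndec V)) (l : PosRoot V × Bool) : Prop :=
  IsCluster K T ∧ IsCluster K T' ∧ (T ∩ T').card + 1 = Fintype.card V ∧
    (∃ M : QuiverRep K V, M.IsIndecWithDim l.1.1 ∧ ∀ v ∈ T ∩ T', gVector v ∈ M.domain) ∧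
    ∀ v ∈ T' \ T, if l.2 then 0 < ∑ i, gVector v i * (l.1.1 i : ℝ)
      else ∑ i, gVector v i * (l.1.1 i : ℝ) < 0

/-- `T 0, T 1, …, T k = T 0` are the successive vertices, and `l 0, …, l (k - 1)` the labels of the
successive edges, on the boundary of the `k`-gon `E(ρ)` dual to the codimension two simplex `ρ`. The
vertices of `E(ρ)` are the clusters that contain `ρ`. -/
structure IsDualPolygon (ρ : Finset (ClusterIndec V)) (k : ℕ)
    (T : ℕ → Finset (ClusterIndec V)) (l : ℕ → PosRoot V × Bool) : Prop where
  simplex : IsSimplex K ρ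
  codim_two : ρ.card + 2 = Fintype.card V
  three_le : 3 ≤ k
  closed : T k = T 0
  injOn : Set.InjOn T (Set.Iio k)
  vertices : ∀ C, (IsCluster K C ∧ ρ ⊆ C) ↔ ∃ i < k, T i = C
  edge : ∀ i < k, DualEdge K (T i) (T (i + 1)) (l i)

variable (V)

/-- The relators read off from the boundaries of the 2-dimensional faces of the dual complex. -/
def pictureRels : Set (FreeGroup (PosRoot V)) :=
  {r | ∃ ρ k T l, IsDualPolygon K ρ k T l ∧ r = FreeGroup.mk ((List.range k).map l)}

/-- The picture group of a simply laced Dynkin quiver. -/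
abbrev PictureGroup : Type := PresentedGroup (pictureRels K V)

end Picture

/-! ### The quiver of type `A_n` with straight orientation -/

/-- The vertices of the quiver `1 ← 2 ← ⋯ ← n`, with `{1, …, n}` replaced by `Fin n`. -/
def LinearA (n : ℕ) : Type := Fin n

instance (n : ℕ) : Fintype (LinearA n) := inferInstanceAs (Fintype (Fin n))

instance (n : ℕ) : DecidableEq (LinearA n) := inferInstanceAs (DecidableEq (Fin n))

/-- The position of a vertex. -/
def LinearA.pos {n : ℕ} (i : LinearA n) : ℕ := Fin.val (n := n) i

/-- There is exactly one arrow `j + 1 ⟶ j`, and there are no other arrows. -/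
instance (n : ℕ) : Quiver.{0} (LinearA n) where
  Hom i j := PLift (i.pos = j.pos + 1)

instance (n : ℕ) (i j : LinearA n) : Fintype (i ⟶ j) :=
  inferInstanceAs (Fintype (PLift (i.pos = j.pos + 1)))

/-! Put n = m + 1 and take the points 0, …, m. The positive roots of the linear quiver are the
indicators of the intervals [i, j) with 0 ≤ i < j ≤ m, so both groups have generators indexed by
pairs i < j. The isomorphism matches these generators, and each set of relations has to be derived
from the other.

The cluster complex is first made combinatorial. Every indecomposable object becomes a nonempty
proper interval of {0, …, m}, its `tube`: the support [s, e) for M_[s,e), and [i + 1, m + 1) for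
P_i[1]. The g-vector pairs with the root [a, b) to [a ∈ tube] − [b ∈ tube]
(`sum_gVector_mul_indicator`), and Ext-orthogonal means nested or disjoint and not adjacent
(`extOrthogonal_iff`). Clusters are thus the maximal tubings of a path. A wall labelled [a, b) is a
tubing one short of maximal that does not separate a from b, and the sign of a crossing says which
of a, b the new tube contains.

From the picture group to the Stasheff group no classification of polygons is needed. Each cluster
receives an element of the Stasheff group, its `potential`: an ordered product of the x_{pq} for
which the smallest tube around p ends at q. A positive crossing of the wall (a, b) multiplies it on
the right by x_{ab} (`Crossing.potential_eq`), because only one thing changes: the smallest tube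
around a ends at b instead of at the end t of the surrounding tube. The Stasheff relations are
exactly what moves the new factor x_{ab} to the right end and absorbs x_{at}. Around a closed
polygon the product of the labels is therefore 1.

In the other direction each Stasheff relation is read off from one explicit face: a pentagon for the
commutator relation, squares for disjoint and for nested pairs. Tubes that isolate all points
outside the set S of three or four indices (`gapTubes`) reduce the problem to tubings of S. -/

namespace LinearA

/-! ### Positive roots of the linear quiver are intervals. -/

variable {m : ℕ}

/-- The vertex at a given position. -/
def vertex (k : ℕ) (h : k < m) : LinearA m := (⟨k, h⟩ : Fin m)

@[simp] theorem pos_vertex (k : ℕ) (h : k < m) : (vertex k h : LinearA m).pos = k := rfl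

theorem pos_lt (i : LinearA m) : i.pos < m := Fin.is_lt (n := m) i

@[simp] theorem vertex_pos (i : LinearA m) : vertex i.pos i.pos_lt = i := rfl

theorem pos_injective : Function.Injective (pos : LinearA m → ℕ) := fun _ _ h => Fin.ext h

theorem pos_eq_of_hom {i j : LinearA m} (f : i ⟶ j) : i.pos = j.pos + 1 := PLift.down f

/-- The arrow between consecutive vertices. -/
def arrow {i j : LinearA m} (h : i.pos = j.pos + 1) : i ⟶ j := PLift.up h

@[simp] theorem card_eq : Fintype.card (LinearA m) = m := Fintype.card_fin m

theorem card_hom (i j : LinearA m) :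
    Fintype.card (i ⟶ j) = if i.pos = j.pos + 1 then 1 else 0 := by
  split_ifs with h
  · rw [Fintype.card_eq_one_iff]
    exact ⟨arrow h, fun _ => rfl⟩
  · rw [Fintype.card_eq_zero_iff]
    exact ⟨fun f => h (pos_eq_of_hom f)⟩

/-- Extension by zero of a function on the vertices to all natural numbers. -/
def extend {R : Type*} [Zero R] (w : LinearA m → R) (k : ℕ) : R :=
  if h : k < m then w (vertex k h) else 0

theorem extend_pos {R : Type*} [Zero R] (w : LinearA m → R) (i : LinearA m) :
    extend w i.pos = w i := by
  simp [extend, i.pos_lt]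

theorem extend_of_le {R : Type*} [Zero R] (w : LinearA m → R) {k : ℕ} (h : m ≤ k) :
    extend w k = 0 := by
  simp [extend, h]

theorem sum_eq_sum_range {R : Type*} [AddCommMonoid R] (w : ℕ → R) :
    ∑ i : LinearA m, w i.pos = ∑ k ∈ Finset.range m, w k :=
  Fin.sum_univ_eq_sum_range w m

theorem sum_ite_pos_eq {R : Type*} [AddCommMonoid R] (w : LinearA m → R) (k : ℕ) :
    ∑ i : LinearA m, (if i.pos = k then w i else 0) = extend w k := by
  by_cases h : k < m
  · rw [Finset.sum_eq_single (vertex k h)]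
    · simp [extend, h]
    · intro i _ hi
      rw [if_neg]
      rintro rfl
      exact hi (by simp)
    · simp
  · rw [extend_of_le w (by omega)]
    refine Finset.sum_eq_zero fun i _ => if_neg ?_
    have := i.pos_lt
    omega

/-- The indicator function of `[a, b)` on the vertices. -/
def indicator (m a b : ℕ) (i : LinearA m) : ℕ := if a ≤ i.pos ∧ i.pos < b then 1 else 0

/-- Completing squares turns twice the Tits form into the sum of the squared jumps of α, extended by
zero at both ends. The final jump is included because `extend α m = 0`. -/
theorem tits_eq (α : LinearA m → ℕ) :
    2 * (∑ i, (α i : ℤ) ^ 2 - ∑ i, ∑ j, (Fintype.card (i ⟶ j) : ℤ) * (α i : ℤ) * (α j : ℤ)) =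
      ((extend α 0 : ℕ) : ℤ) ^ 2 +
        ∑ k ∈ Finset.range m, (((extend α (k + 1) : ℕ) : ℤ) - (extend α k : ℕ)) ^ 2 := by
  have h1 : ∑ i, (α i : ℤ) ^ 2 = ∑ k ∈ Finset.range m, ((extend α k : ℕ) : ℤ) ^ 2 := by
    rw [← sum_eq_sum_range (m := m) fun k => ((extend α k : ℕ) : ℤ) ^ 2]
    simp [extend_pos]
  have h2 : ∑ i, ∑ j, (Fintype.card (i ⟶ j) : ℤ) * (α i : ℤ) * (α j : ℤ) =
      ∑ k ∈ Finset.range m, ((extend α (k + 1) : ℕ) : ℤ) * (extend α k : ℕ) := by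
    rw [Finset.sum_comm, ← sum_eq_sum_range (m := m)
      fun k => ((extend α (k + 1) : ℕ) : ℤ) * (extend α k : ℕ)]
    refine Finset.sum_congr rfl fun j _ => ?_
    rw [extend_pos, ← Finset.sum_mul, ← sum_ite_pos_eq α]
    push_cast
    congr 1
    refine Finset.sum_congr rfl fun i _ => ?_
    rw [card_hom]
    split_ifs <;> simp
  have h3 : ∑ k ∈ Finset.range m, ((extend α (k + 1) : ℕ) : ℤ) ^ 2 + ((extend α 0 : ℕ) : ℤ) ^ 2 =
      ∑ k ∈ Finset.range m, ((extend α k : ℕ) : ℤ) ^ 2 := by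
    rw [← Finset.sum_range_succ' (fun k => ((extend α k : ℕ) : ℤ) ^ 2), Finset.sum_range_succ,
      extend_of_le α le_rfl]
    simp
  have h4 : ∑ k ∈ Finset.range m, (((extend α (k + 1) : ℕ) : ℤ) - (extend α k : ℕ)) ^ 2 =
      ∑ k ∈ Finset.range m, ((extend α (k + 1) : ℕ) : ℤ) ^ 2 +
      ∑ k ∈ Finset.range m, ((extend α k : ℕ) : ℤ) ^ 2 -
      2 * ∑ k ∈ Finset.range m, ((extend α (k + 1) : ℕ) : ℤ) * (extend α k : ℕ) := by
    rw [Finset.mul_sum, ← Finset.sum_add_distrib, ← Finset.sum_sub_distrib]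
    exact Finset.sum_congr rfl fun k _ => by ring
  rw [h1, h2, h4]
  linarith

/-- The first rise from 0 and the first return to 0 each contribute at least 1 to a sum equal to 2.
Hence both jumps have size 1 and no other jump occurs. -/
theorem exists_plateau {f : ℕ → ℤ} {N : ℕ} (h0 : f 0 = 0) (hN : ∀ k, N ≤ k → f k = 0)
    (hf : ∀ k, 0 ≤ f k)
    (hsum : ∑ k ∈ Finset.range N, (f (k + 1) - f k) ^ 2 = 2) :
    ∃ a b, a < b ∧ b < N ∧ ∀ k, f k = if a < k ∧ k ≤ b then 1 else 0 := by
  classical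
  have hne : ∃ k, f (k + 1) ≠ 0 := by
    by_contra! h
    have hz : ∀ k, f k = 0 := fun k => by cases k <;> simp [h0, h]
    simp [hz] at hsum
  obtain ⟨a, ha, hamin⟩ : ∃ a, f (a + 1) ≠ 0 ∧ ∀ k ≤ a, f k = 0 := by
    refine ⟨Nat.find hne, Nat.find_spec hne, fun k hk => ?_⟩
    cases k with
    | zero => exact h0
    | succ k => simpa using Nat.find_min hne (m := k) (by omega)
  have hex : ∃ k, f (a + 1 + k + 1) = 0 := ⟨N, hN _ (by omega)⟩
  obtain ⟨c, hc, hcmin⟩ : ∃ c, f (a + 1 + c + 1) = 0 ∧ ∀ k ≤ c, f (a + 1 + k) ≠ 0 := by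
    refine ⟨Nat.find hex, Nat.find_spec hex, fun k hk => ?_⟩
    cases k with
    | zero => exact ha
    | succ k => exact Nat.find_min hex (m := k) (by omega)
  have hpos : ∀ k, f k ≠ 0 → 1 ≤ f k := fun k hk => by have := hf k; omega
  have hbN : a + 1 + c < N := by
    by_contra h
    exact hcmin c le_rfl (hN _ (by omega))
  have key : ∀ S ⊆ Finset.range N, ∑ k ∈ S, (f (k + 1) - f k) ^ 2 ≤ 2 := fun S hS =>
    hsum ▸ Finset.sum_le_sum_of_subset_of_nonneg hS fun _ _ _ => sq_nonneg _
  have hfa := hamin a le_rfl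
  have h1 : 1 ≤ f (a + 1) := hpos _ ha
  have h2 : 1 ≤ f (a + 1 + c) := hpos _ (hcmin c le_rfl)
  have hab := key {a, a + 1 + c} (by
    intro k hk
    simp only [Finset.mem_insert, Finset.mem_singleton] at hk
    rw [Finset.mem_range]; omega)
  rw [Finset.sum_pair (by omega), hfa, hc] at hab
  have hstep : ∀ k, k ≠ a → k ≠ a + 1 + c → f (k + 1) = f k := by
    intro k hka hkb
    by_cases hkN : k < N
    · have := key {k, a, a + 1 + c} (by
        intro k hk
        simp only [Finset.mem_insert, Finset.mem_singleton] at hk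
        rw [Finset.mem_range]; omega)
      rw [Finset.sum_insert (by simp [hka, hkb]), Finset.sum_pair (by omega), hfa, hc] at this
      have : (f (k + 1) - f k) ^ 2 = 0 := by nlinarith [sq_nonneg (f (k + 1) - f k)]
      have := pow_eq_zero_iff (two_ne_zero) |>.1 this
      omega
    · rw [hN _ (by omega), hN _ (by omega)]
  have hone : f (a + 1) = 1 := by nlinarith
  have hmid : ∀ k ≤ c, f (a + 1 + k) = 1 := by
    intro k
    induction k with
    | zero => exact fun _ => hone
    | succ k ih =>
      intro hk
      rw [← ih (by omega)]
      exact hstep (a + 1 + k) (by omega) (by omega)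
  have hend : ∀ k, f (a + 1 + c + 1 + k) = 0 := by
    intro k
    induction k with
    | zero => exact hc
    | succ k ih =>
      rw [← ih]
      exact hstep (a + 1 + c + 1 + k) (by omega) (by omega)
  refine ⟨a, a + 1 + c, by omega, hbN, fun k => ?_⟩
  split_ifs with hk
  · obtain ⟨d, rfl⟩ := Nat.exists_eq_add_of_le (show a + 1 ≤ k by omega)
    exact hmid d (by omega)
  · by_cases hka : k ≤ a
    · exact hamin k hka
    · obtain ⟨d, rfl⟩ := Nat.exists_eq_add_of_le (show a + 1 + c + 1 ≤ k by omega)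
      exact hend d

theorem sum_sq_diff_eq (α : LinearA m → ℕ) :
    ∑ k ∈ Finset.range (m + 1), ((if k + 1 = 0 then (0 : ℤ) else (extend α (k + 1 - 1) : ℕ)) -
      (if k = 0 then (0 : ℤ) else (extend α (k - 1) : ℕ))) ^ 2 =
      ((extend α 0 : ℕ) : ℤ) ^ 2 +
        ∑ k ∈ Finset.range m, (((extend α (k + 1) : ℕ) : ℤ) - (extend α k : ℕ)) ^ 2 := by
  rw [Finset.sum_range_succ']
  simp [add_comm]

theorem extend_indicator {a b : ℕ} (hb : b ≤ m) (k : ℕ) :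
    extend (indicator m a b) k = if a ≤ k ∧ k < b then 1 else 0 := by
  unfold extend indicator
  by_cases hk : k < m
  · rw [dif_pos hk, pos_vertex]
  · rw [dif_neg hk, if_neg (by omega)]

theorem tits_indicator {a b : ℕ} (hab : a < b) (hb : b ≤ m) :
    ∑ i, (indicator m a b i : ℤ) ^ 2 - ∑ i, ∑ j, (Fintype.card (i ⟶ j) : ℤ) *
      (indicator m a b i : ℤ) * (indicator m a b j : ℤ) = 1 := by
  have h := tits_eq (indicator m a b)
  have he := extend_indicator (a := a) hb
  rw [← sum_sq_diff_eq] at h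
  have hs : ∀ k ∈ Finset.range (m + 1),
      ((if k + 1 = 0 then (0 : ℤ) else (extend (indicator m a b) (k + 1 - 1) : ℕ)) -
      (if k = 0 then (0 : ℤ) else (extend (indicator m a b) (k - 1) : ℕ))) ^ 2 =
      (if k = a then 1 else 0) + (if k = b then 1 else 0) := by
    intro k _
    simp only [he]
    split_ifs <;> first | omega | contradiction
  rw [Finset.sum_congr rfl hs, Finset.sum_add_distrib, Finset.sum_ite_eq', Finset.sum_ite_eq',
    if_pos (by simp; omega), if_pos (by simp; omega)] at h
  omega

theorem exists_eq_indicator {α : LinearA m → ℕ}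
    (h : ∑ i, (α i : ℤ) ^ 2 - ∑ i, ∑ j, (Fintype.card (i ⟶ j) : ℤ) * (α i : ℤ) * (α j : ℤ) = 1) :
    ∃ a b, a < b ∧ b ≤ m ∧ α = indicator m a b := by
  -- The function is shifted by one so that index 0 holds the zero boundary value on the left.
  obtain ⟨a, b, hab, hb, hf⟩ := exists_plateau (N := m + 1)
    (f := fun k => if k = 0 then (0 : ℤ) else (extend α (k - 1) : ℕ)) (by simp)
    (fun k hk => by
      rw [if_neg (by omega), extend_of_le α (by omega)]; rfl)
    (fun k => by split_ifs <;> simp)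
    (by rw [sum_sq_diff_eq, ← tits_eq, h]; norm_num)
  refine ⟨a, b, hab, by omega, funext fun i => ?_⟩
  have := hf (i.pos + 1)
  simp only [Nat.add_eq_zero_iff, one_ne_zero, and_false, if_false, Nat.add_sub_cancel,
    extend_pos] at this
  unfold indicator
  split_ifs at this ⊢ <;> omega

theorem indicator_inj {a b c d : ℕ} (hab : a < b) (hb : b ≤ m) (hcd : c < d) (hd : d ≤ m)
    (h : indicator m a b = indicator m c d) : a = c ∧ b = d := by
  have key : ∀ k, k < m → ((a ≤ k ∧ k < b) ↔ (c ≤ k ∧ k < d)) := fun k hk => by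
    have := congrFun h (vertex k hk)
    simp only [indicator, pos_vertex] at this
    by_cases h1 : a ≤ k ∧ k < b <;> by_cases h2 : c ≤ k ∧ k < d <;> (simp_all; try omega)
  have h1 := key a (by omega)
  have h2 := key c (by omega)
  have h3 := key (b - 1) (by omega)
  have h4 := key (d - 1) (by omega)
  omega

end LinearA

/-! ### Tubes of indecomposable objects and their g-vectors. -/

open LinearA

/-- The positive root with support `[i, j)`. -/
def intervalRoot {m : ℕ} (p : StasheffGen (m + 1)) : PosRoot (LinearA m) :=
  ⟨indicator m p.1.1 p.1.2, tits_indicator p.2 (Nat.lt_succ_iff.1 p.1.2.2)⟩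

theorem intervalRoot_bijective (m : ℕ) :
    Function.Bijective (intervalRoot : StasheffGen (m + 1) → PosRoot (LinearA m)) := by
  constructor
  · rintro ⟨⟨a, b⟩, hab⟩ ⟨⟨c, d⟩, hcd⟩ h
    obtain ⟨h1, h2⟩ := indicator_inj (m := m) hab (Nat.lt_succ_iff.1 b.2) hcd
      (Nat.lt_succ_iff.1 d.2) (congrArg Subtype.val h)
    simp only [Subtype.mk.injEq, Prod.mk.injEq]
    exact ⟨Fin.ext h1, Fin.ext h2⟩
  · rintro ⟨α, hα⟩
    obtain ⟨a, b, hab, hb, rfl⟩ := exists_eq_indicator hα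
    exact ⟨⟨(⟨a, by omega⟩, ⟨b, by omega⟩), hab⟩, rfl⟩

/-- Positive roots of the linear quiver correspond to the pairs `i < j`. -/
noncomputable def rootEquiv (m : ℕ) : StasheffGen (m + 1) ≃ PosRoot (LinearA m) :=
  Equiv.ofBijective _ (intervalRoot_bijective m)

/-- The interval `[s, e)` of `{0, …, m}` on which the piecewise constant function with slopes the
`g`-vector is lowest. -/
noncomputable def tube {m : ℕ} : ClusterIndec (LinearA m) → ℕ × ℕ
  | Sum.inl α => (((rootEquiv m).symm α).1.1, ((rootEquiv m).symm α).1.2)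
  | Sum.inr i => (i.pos + 1, m + 1)

/-- The intervals `[s, e)` that arise from indecomposable objects. -/
def IsTube (m : ℕ) (I : ℕ × ℕ) : Prop := I.1 < I.2 ∧ I.2 ≤ m + 1 ∧ (0 < I.1 ∨ I.2 ≤ m)

theorem tube_inl_fst_lt {m : ℕ} (α : PosRoot (LinearA m)) :
    (tube (Sum.inl α)).1 < (tube (Sum.inl α)).2 := ((rootEquiv m).symm α).2

theorem tube_inl_snd_le {m : ℕ} (α : PosRoot (LinearA m)) : (tube (Sum.inl α)).2 ≤ m :=
  Nat.lt_succ_iff.1 ((rootEquiv m).symm α).1.2.2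

theorem root_eq_indicator {m : ℕ} (α : PosRoot (LinearA m)) :
    α.1 = indicator m (tube (Sum.inl α)).1 (tube (Sum.inl α)).2 :=
  congrArg Subtype.val ((rootEquiv m).apply_symm_apply α).symm

theorem isTube_tube {m : ℕ} (v : ClusterIndec (LinearA m)) : IsTube m (tube v) := by
  rcases v with α | i
  · exact ⟨tube_inl_fst_lt α, (tube_inl_snd_le α).trans (Nat.le_succ m), Or.inr (tube_inl_snd_le α)⟩
  · exact ⟨Nat.succ_lt_succ i.pos_lt, le_rfl, Or.inl (Nat.succ_pos _)⟩

theorem tube_injective (m : ℕ) :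
    Function.Injective (tube : ClusterIndec (LinearA m) → ℕ × ℕ) := by
  rintro (α | i) (β | j) h
  · congr 1
    apply Subtype.ext
    rw [root_eq_indicator, root_eq_indicator, h]
  · have := tube_inl_snd_le α
    rw [h] at this
    simp [tube] at this
  · have := tube_inl_snd_le β
    rw [← h] at this
    simp [tube] at this
  · congr 1
    apply pos_injective
    simpa [tube] using h

theorem tube_rootEquiv {m : ℕ} (p : StasheffGen (m + 1)) :
    tube (Sum.inl (rootEquiv m p)) = ((p.1.1 : ℕ), (p.1.2 : ℕ)) := by
  simp [tube]

theorem exists_tube_eq {m : ℕ} {I : ℕ × ℕ} (h : IsTube m I) :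
    ∃ v : ClusterIndec (LinearA m), tube v = I := by
  obtain ⟨s, e⟩ := I
  obtain ⟨h1, h2, h3⟩ := h
  simp only at h1 h2 h3
  by_cases he : e ≤ m
  · exact ⟨Sum.inl (rootEquiv m ⟨(⟨s, by omega⟩, ⟨e, by omega⟩), h1⟩), tube_rootEquiv _⟩
  · refine ⟨Sum.inr (vertex (s - 1) (by omega)), ?_⟩
    simp only [tube, pos_vertex, Prod.mk.injEq]
    omega

/-- The resolution P_{s-1} → P_{e-1} of M_[s,e) gives e_{e-1} − e_{s-1}, without the second term if
s = 0. The tube of P_i[1] ends at m + 1 so that the same formula holds: no vertex has position m,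
and only −e_i remains. -/
theorem gVector_eq {m : ℕ} (v : ClusterIndec (LinearA m)) (j : LinearA m) :
    gVector v j = (if j.pos = (tube v).2 - 1 then 1 else 0) -
      (if j.pos + 1 = (tube v).1 then 1 else 0) := by
  have hj := j.pos_lt
  rcases v with α | i
  · have h1 := tube_inl_fst_lt α
    have h2 := tube_inl_snd_le α
    have h : gVector (Sum.inl α) j = (α.1 j : ℝ) - extend α.1 (j.pos + 1) := by
      rw [← sum_ite_pos_eq]
      push_cast
      simp only [gVector]
      congr 1
      refine Finset.sum_congr rfl fun i _ => ?_
      rw [card_hom]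
      split_ifs <;> simp
    have he : extend α.1 (j.pos + 1) =
        if (tube (Sum.inl α)).1 ≤ j.pos + 1 ∧ j.pos + 1 < (tube (Sum.inl α)).2 then 1 else 0 := by
      conv_lhs => rw [root_eq_indicator]
      unfold extend indicator
      split_ifs <;> simp_all
      omega
    rw [h, he]
    conv_lhs => rw [root_eq_indicator]
    unfold indicator
    split_ifs <;> first | omega | norm_num
  · simp only [gVector, tube, Nat.add_sub_cancel, add_left_inj]
    rw [if_neg (show ¬ j.pos = m by omega)]
    by_cases h : j = i
    · simp [h]
    · rw [if_neg h, if_neg fun h' => h (pos_injective h')]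
      simp

theorem sum_gVector_mul {m : ℕ} (v : ClusterIndec (LinearA m)) (w : LinearA m → ℝ) :
    ∑ i, gVector v i * w i = extend w ((tube v).2 - 1) -
      if (tube v).1 = 0 then 0 else extend w ((tube v).1 - 1) := by
  have : ∀ i, gVector v i * w i = (if i.pos = (tube v).2 - 1 then w i else 0) -
      (if (tube v).1 = 0 then 0 else if i.pos = (tube v).1 - 1 then w i else 0) := by
    intro i
    rw [gVector_eq, sub_mul]
    congr 1
    · simp
    · split_ifs <;> first | omega | simp
  simp only [this, Finset.sum_sub_distrib, sum_ite_pos_eq]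
  split_ifs <;> simp [sum_ite_pos_eq]

/-- Membership of a point in the half-open interval. -/
abbrev InTube (I : ℕ × ℕ) (c : ℕ) : Prop := I.1 ≤ c ∧ c < I.2

-- Membership of x in [s, e) is [x < e] − [x < s], and the pairing is ([a < e] − [b < e]) − ([a < s]
-- − [b < s]). Through this formula walls and crossing directions become statements about which
-- tubes contain a and b.
open Classical in
theorem sum_gVector_mul_indicator {m a b : ℕ} (hab : a < b) (hb : b ≤ m)
    (v : ClusterIndec (LinearA m)) :
    ∑ i, gVector v i * (indicator m a b i : ℝ) =
      (if InTube (tube v) a then 1 else 0) - (if InTube (tube v) b then 1 else 0) := by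
  obtain ⟨h1, h2, h3⟩ := isTube_tube v
  rw [sum_gVector_mul]
  have he : ∀ k, extend (fun i => (indicator m a b i : ℝ)) k =
      if a ≤ k ∧ k < b then 1 else 0 := by
    intro k
    have h := extend_indicator (a := a) hb k
    by_cases hk : k < m
    · simp only [extend, hk, dif_pos] at h ⊢
      rw [h]
      split_ifs <;> simp
    · rw [extend_of_le _ (by omega), if_neg (by omega)]
  rw [he, he]
  unfold InTube
  split_ifs <;> first | omega | norm_num

theorem sum_gVector_mul_indicator_pos_iff {m a b : ℕ} (hab : a < b) (hb : b ≤ m)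
    (v : ClusterIndec (LinearA m)) :
    0 < ∑ i, gVector v i * (indicator m a b i : ℝ) ↔
      InTube (tube v) a ∧ ¬ InTube (tube v) b := by
  rw [sum_gVector_mul_indicator hab hb]
  split_ifs with h1 h2 h2
  · exact iff_of_false (by norm_num) fun h => h.2 h2
  · exact iff_of_true (by norm_num) ⟨h1, h2⟩
  · exact iff_of_false (by norm_num) fun h => h1 h.1
  · exact iff_of_false (by norm_num) fun h => h1 h.1

theorem sum_gVector_mul_indicator_neg_iff {m a b : ℕ} (hab : a < b) (hb : b ≤ m)
    (v : ClusterIndec (LinearA m)) :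
    ∑ i, gVector v i * (indicator m a b i : ℝ) < 0 ↔
      ¬ InTube (tube v) a ∧ InTube (tube v) b := by
  rw [sum_gVector_mul_indicator hab hb]
  split_ifs with h1 h2 h2
  · exact iff_of_false (by norm_num) fun h => h.1 h1
  · exact iff_of_false (by norm_num) fun h => h.1 h1
  · exact iff_of_true (by norm_num) ⟨h1, h2⟩
  · exact iff_of_false (by norm_num) fun h => h2 h.2

theorem sum_gVector_mul_indicator_eq_zero_iff {m a b : ℕ} (hab : a < b) (hb : b ≤ m)
    (v : ClusterIndec (LinearA m)) :
    ∑ i, gVector v i * (indicator m a b i : ℝ) = 0 ↔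
      (InTube (tube v) a ↔ InTube (tube v) b) := by
  rw [sum_gVector_mul_indicator hab hb]
  split_ifs with h1 h2 h2
  · exact iff_of_true (by norm_num) (iff_of_true h1 h2)
  · exact iff_of_false (by norm_num) fun h => h2 (h.1 h1)
  · exact iff_of_false (by norm_num) fun h => h1 (h.2 h2)
  · exact iff_of_true (by norm_num) (iff_of_false h1 h2)

/-! ### Path actions and morphisms out of projectives. -/

namespace QuiverRep

variable {K : Type u} [Field K] {V : Type} [Quiver.{0} V]

/-- The action of a path on a representation. -/
def pathMap (M : QuiverRep K V) {i : V} :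
    ∀ {j : V}, Quiver.Path i j → (M.space i →ₗ[K] M.space j)
  | _, .nil => LinearMap.id
  | _, .cons p a => M.map a ∘ₗ pathMap M p

@[simp] theorem pathMap_nil (M : QuiverRep K V) {i : V} :
    M.pathMap (.nil : Quiver.Path i i) = LinearMap.id := rfl

@[simp] theorem pathMap_cons (M : QuiverRep K V) {i j k : V} (p : Quiver.Path i j) (a : j ⟶ k) :
    M.pathMap (p.cons a) = M.map a ∘ₗ M.pathMap p := rfl

theorem Hom.app_pathMap {M N : QuiverRep K V} (f : Hom M N) {i j : V} (p : Quiver.Path i j)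
    (x : M.space i) : f.app j (M.pathMap p x) = N.pathMap p (f.app i x) := by
  induction p with
  | nil => rfl
  | cons p a ih => simp [f.comm, ih]

/-- The basis element of `P_i` given by a path. -/
noncomputable def projElem (K : Type u) [Field K] {i j : V} (p : Quiver.Path i j) :
    (proj K i).space j :=
  Finsupp.single p (1 : K)

theorem proj_pathMap {i j : V} (p : Quiver.Path i j) :
    (proj K i).pathMap p (projElem K .nil) = projElem K p := by
  induction p with
  | nil => rfl
  | cons p a ih =>
    rw [pathMap_cons, LinearMap.comp_apply, ih]
    exact Finsupp.mapDomain_single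

theorem proj_hom_ext {i j : V} {M : Type*} [AddCommGroup M] [Module K M]
    {f g : (proj K i).space j →ₗ[K] M} (h : ∀ p, f (projElem K p) = g (projElem K p)) : f = g :=
  Finsupp.lhom_ext' fun p => LinearMap.ext_ring (h p)

/-- The morphism `P_i → M` determined by an element of `M_i`. -/
noncomputable def homOfElem (M : QuiverRep K V) {i : V} (x : M.space i) : Hom (proj K i) M where
  app j := Finsupp.linearCombination K fun p : Quiver.Path i j => M.pathMap p x
  comm {j k} a y := by
    have h : (Finsupp.linearCombination K fun p : Quiver.Path i k => M.pathMap p x) ∘ₗ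
        Finsupp.lmapDomain K K (fun p : Quiver.Path i j => p.cons a) =
        M.map a ∘ₗ Finsupp.linearCombination K fun p : Quiver.Path i j => M.pathMap p x := by
      apply Finsupp.lhom_ext
      intro p r
      simp
    exact LinearMap.congr_fun h y

theorem homOfElem_app (M : QuiverRep K V) {i : V} (x : M.space i) :
    (M.homOfElem x).app i (projElem K .nil) = x := by
  refine (Finsupp.linearCombination_single K 1 (Quiver.Path.nil : Quiver.Path i i)).trans ?_
  simp

/-- Yoneda: a morphism out of `proj K i` is determined by the image of the trivial path, which is
arbitrary. -/
theorem homVanishes_proj_iff (M : QuiverRep K V) (i : V) :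
    (proj K i).HomVanishes M ↔ ∀ x : M.space i, x = 0 := by
  constructor
  · intro h x
    rw [← M.homOfElem_app x]
    exact h _ _ _
  · intro h f j x
    suffices hf : f.app j = 0 by rw [hf]; rfl
    apply proj_hom_ext
    intro p
    rw [← proj_pathMap, f.app_pathMap, h (f.app i _), map_zero, LinearMap.zero_apply]

end QuiverRep

namespace LinearA

variable {m : ℕ}

theorem pos_le_of_path {i j : LinearA m} (p : Quiver.Path i j) : j.pos ≤ i.pos := by
  induction p with
  | nil => exact le_rfl
  | cons p a ih =>
    have := pos_eq_of_hom a
    omega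

theorem exists_path {i j : LinearA m} (h : j.pos ≤ i.pos) : Nonempty (Quiver.Path i j) := by
  obtain ⟨d, hd⟩ := Nat.exists_eq_add_of_le h
  induction d generalizing j with
  | zero =>
    obtain rfl : i = j := pos_injective (by omega)
    exact ⟨.nil⟩
  | succ d ih =>
    have hi := i.pos_lt
    obtain ⟨p⟩ := ih (j := vertex (j.pos + 1) (by omega)) (by simp; omega) (by simp; omega)
    exact ⟨p.cons (arrow (by simp))⟩

instance (i j : LinearA m) : Subsingleton (i ⟶ j) := 
  inferInstanceAs (Subsingleton (PLift _))

theorem path_unique {i j : LinearA m} (p q : Quiver.Path i j) : p = q := by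
  induction p with
  | nil =>
    cases q with
    | nil => rfl
    | cons q a =>
      have := pos_le_of_path q
      have := pos_eq_of_hom a
      omega
  | cons p a ih =>
    cases q with
    | nil =>
      have := pos_le_of_path p
      have := pos_eq_of_hom a
      omega
    | cons q a' =>
      have h1 := pos_eq_of_hom a
      have h2 := pos_eq_of_hom a'
      rename_i x y z
      obtain rfl : x = z := pos_injective (by omega)
      rw [ih q, Subsingleton.elim a a']

end LinearA

namespace QuiverRep

/-! ### Interval representations: indecomposability, vanishing of Ext, domains. -/

section IntervalRep

variable (K : Type u) [Field K] (m a b : ℕ)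

/-- The line at the vertices in `[a, b)` and zero elsewhere. -/
def intervalSpace (i : LinearA m) : Submodule K K where
  carrier := {x | ¬ (a ≤ i.pos ∧ i.pos < b) → x = 0}
  add_mem' hx hy h := by rw [hx h, hy h, add_zero]
  zero_mem' _ := rfl
  smul_mem' c x hx h := by rw [hx h, smul_zero]

/-- The indecomposable representation with support `[a, b)`. -/
def intervalRep : QuiverRep K (LinearA m) where
  space i := intervalSpace K m a b i
  map {i j} _ :=
    { toFun x := ⟨if a ≤ j.pos ∧ j.pos < b then x.1 else 0, fun h => if_neg h⟩
      map_add' x y := by ext; dsimp; split_ifs <;> simp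
      map_smul' c x := by ext; dsimp; split_ifs <;> simp }

variable {K m a b}

/-- The coordinate of an element of a one-dimensional interval representation. -/
def val {i : LinearA m} : (intervalRep K m a b).space i →ₗ[K] K :=
  (intervalSpace K m a b i).subtype

/-- The element with a given coordinate. -/
def ofVal {i : LinearA m} (hi : a ≤ i.pos ∧ i.pos < b) (c : K) : (intervalRep K m a b).space i :=
  (⟨c, fun h => absurd hi h⟩ : intervalSpace K m a b i)

@[simp] theorem val_ofVal {i : LinearA m} (hi : a ≤ i.pos ∧ i.pos < b) (c : K) :
    val (ofVal hi c) = c := rfl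

theorem intervalRep_map_val {i j : LinearA m} (f : i ⟶ j) (x : (intervalRep K m a b).space i) :
    val ((intervalRep K m a b).map f x) = if a ≤ j.pos ∧ j.pos < b then val x else 0 := rfl

theorem intervalRep_val_eq_zero {i : LinearA m} (x : (intervalRep K m a b).space i)
    (h : ¬ (a ≤ i.pos ∧ i.pos < b)) : val x = 0 := x.2 h

theorem intervalRep_ext {i : LinearA m} {x y : (intervalRep K m a b).space i} (h : val x = val y) :
    x = y := Subtype.ext h

theorem intervalRep_pathMap_val {i j : LinearA m} (p : Quiver.Path i j)
    (x : (intervalRep K m a b).space i) :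
    val ((intervalRep K m a b).pathMap p x) = if a ≤ j.pos ∧ j.pos < b then val x else 0 := by
  induction p with
  | nil =>
    split_ifs with h
    · rfl
    · exact intervalRep_val_eq_zero x h
  | @cons j k p f ih =>
    rw [pathMap_cons, LinearMap.comp_apply, intervalRep_map_val]
    have h1 := pos_eq_of_hom f
    have h2 := pos_le_of_path p
    by_cases hk : a ≤ k.pos ∧ k.pos < b
    · rw [if_pos hk, if_pos hk, ih]
      split_ifs with hj
      · rfl
      · exact (intervalRep_val_eq_zero x (by omega)).symm
    · rw [if_neg hk, if_neg hk]

theorem intervalRep_finrank (i : LinearA m) :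
    Module.finrank K ((intervalRep K m a b).space i) = indicator m a b i := by
  unfold indicator
  split_ifs with h
  · have : intervalSpace K m a b i = ⊤ := by
      rw [eq_top_iff]
      exact fun x _ h' => absurd h h'
    change Module.finrank K (intervalSpace K m a b i) = 1
    rw [this]
    simp
  · have : intervalSpace K m a b i = ⊥ := by
      rw [eq_bot_iff]
      exact fun x hx => hx h
    change Module.finrank K (intervalSpace K m a b i) = 0
    rw [this]
    simp

instance intervalRep_finite (i : LinearA m) :
    Module.Finite K ((intervalRep K m a b).space i) :=
  inferInstanceAs (Module.Finite K (intervalSpace K m a b i))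

theorem submodule_intervalRep_eq_bot_or_eq_top {i : LinearA m}
    (A : Submodule K ((intervalRep K m a b).space i)) : A = ⊥ ∨ A = ⊤ := by
  by_cases h : A = ⊥
  · exact Or.inl h
  · right
    obtain ⟨x, hx, hx0⟩ := A.ne_bot_iff.1 h
    have hx1 : val x ≠ 0 := fun h => hx0 (intervalRep_ext (h.trans (map_zero _).symm))
    rw [eq_top_iff]
    intro y _
    have : y = (val y / val x) • x := intervalRep_ext (by
      rw [map_smul, smul_eq_mul, div_mul_cancel₀ _ hx1])
    rw [this]
    exact A.smul_mem _ hx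

/-- The space at b − 1 is a line and generates the representation, so whichever of two complementary
subrepresentations contains that line is everything. -/
theorem intervalRep_isIndecomposable (hab : a < b) (hb : b ≤ m) :
    (intervalRep K m a b).IsIndecomposable := by
  have hgen : ∀ i : LinearA m, a ≤ i.pos ∧ i.pos < b →
      ∃ x : (intervalRep K m a b).space i, val x = 1 := fun i hi => ⟨ofVal hi 1, rfl⟩
  have htop : ∀ A : (intervalRep K m a b).Sub, A.carrier (vertex (b - 1) (by omega)) = ⊤ →
      ∀ i : LinearA m, A.carrier i = ⊤ := by
    intro A hA i
    rcases submodule_intervalRep_eq_bot_or_eq_top (A.carrier i) with h | h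
    · by_cases hi : a ≤ i.pos ∧ i.pos < b
      · obtain ⟨x, hx⟩ := hgen (vertex (b - 1) (by omega)) (by simp; omega)
        obtain ⟨p⟩ := exists_path (i := vertex (b - 1) (by omega)) (j := i) (by simp; omega)
        have hmem : ∀ {j : LinearA m} (p : Quiver.Path (vertex (b - 1) (by omega)) j),
            (intervalRep K m a b).pathMap p x ∈ A.carrier j := by
          intro j p
          induction p with
          | nil => rw [hA]; trivial
          | cons p f ih => exact A.map_mem f _ ih
        have := hmem p
        rw [h, Submodule.mem_bot] at this
        have h1 := intervalRep_pathMap_val p x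
        rw [this, if_pos hi, hx, map_zero] at h1
        exact absurd h1 zero_ne_one
      · rw [eq_top_iff]
        intro x _
        rw [show x = 0 from
          intervalRep_ext ((intervalRep_val_eq_zero x hi).trans (map_zero _).symm)]
        exact Submodule.zero_mem _
    · exact h
  constructor
  · refine ⟨vertex a (by omega), ?_⟩
    obtain ⟨x, hx⟩ := hgen (vertex a (by omega)) (by simpa)
    exact ⟨x, 0, fun h => by rw [h, map_zero] at hx; exact zero_ne_one hx⟩
  · intro A B hAB
    rcases submodule_intervalRep_eq_bot_or_eq_top (A.carrier (vertex (b - 1) (by omega))) with h | h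
    · left
      intro i
      have hB := htop B (by simpa [h] using (hAB (vertex (b - 1) (by omega))).sup_eq_top) i
      simpa [hB] using (hAB i).inf_eq_bot
    · right
      intro i
      have hA := htop A h i
      simpa [hA] using (hAB i).inf_eq_bot

theorem intervalRep_isIndecWithDim (hab : a < b) (hb : b ≤ m) :
    (intervalRep K m a b).IsIndecWithDim (indicator m a b) :=
  ⟨intervalRep_isIndecomposable hab hb, fun i => ⟨inferInstance, intervalRep_finrank i⟩⟩

/-- M_[a,b) has one generator, at b − 1, and at most one relation: the path to a − 1 kills it. Hence
Ext¹(M_[a,b), N) is the cokernel of N_{b-1} → N_{a-1}, and surjectivity allows a lift of the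
generator to be corrected until it satisfies the relation. -/
theorem intervalRep_extVanishes (hab : a < b) (hb : b ≤ m) (N : QuiverRep K (LinearA m))
    (hN : ∀ (i j : LinearA m) (p : Quiver.Path i j), i.pos + 1 = b → j.pos + 1 = a →
      Function.Surjective (N.pathMap p)) :
    (intervalRep K m a b).ExtVanishes N := by
  classical
  intro E f g hf hg hfg
  set t : LinearA m := vertex (b - 1) (by omega) with ht
  have htpos : t.pos = b - 1 := rfl
  obtain ⟨e₀, he₀⟩ := hg t (ofVal (by omega) 1)
  -- The corrected lift of the generator; for a = 0 there is no relation to satisfy.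
  obtain ⟨e, he, hea⟩ : ∃ e, val (g.app t e) = 1 ∧
      ∀ (j : LinearA m) (p : Quiver.Path t j), j.pos + 1 = a → E.pathMap p e = 0 := by
    by_cases ha : a = 0
    · exact ⟨e₀, by rw [he₀, val_ofVal], fun j p hj => by omega⟩
    · set z : LinearA m := vertex (a - 1) (by omega) with hz
      have hzpos : z.pos = a - 1 := rfl
      obtain ⟨p⟩ := exists_path (i := t) (j := z) (by omega)
      have h0 : E.pathMap p e₀ ∈ LinearMap.ker (g.app z) := by
        rw [LinearMap.mem_ker, g.app_pathMap]
        apply intervalRep_ext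
        rw [intervalRep_pathMap_val, if_neg (by omega), map_zero]
      rw [← hfg] at h0
      obtain ⟨n₀, hn₀⟩ := h0
      obtain ⟨n₁, hn₁⟩ := hN t z p (by omega) (by omega) n₀
      refine ⟨e₀ - f.app t n₁, ?_, fun j q hj => ?_⟩
      · have : g.app t (f.app t n₁) = 0 := by
          rw [← LinearMap.mem_ker, ← hfg]
          exact ⟨n₁, rfl⟩
        rw [map_sub, this, sub_zero, he₀, val_ofVal]
      · obtain rfl : j = z := pos_injective (by omega)
        rw [path_unique q p, map_sub, ← f.app_pathMap, hn₁, hn₀, sub_self]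
  -- The section sends the generator's image at j to the image of e along the unique path from t;
  -- the value 0 where no path exists lies outside the support.
  let v : ∀ j : LinearA m, E.space j := fun j =>
    if h : Nonempty (Quiver.Path t j) then E.pathMap h.some e else 0
  have hv : ∀ {j : LinearA m} (p : Quiver.Path t j), v j = E.pathMap p e := by
    intro j p
    have h : Nonempty (Quiver.Path t j) := ⟨p⟩
    simp only [v, dif_pos h]
    rw [path_unique h.some p]
  refine ⟨⟨fun j => LinearMap.toSpanSingleton K _ (v j) ∘ₗ val,
    ?_⟩, ?_⟩
  · intro i j c x
    change val ((intervalRep K m a b).map c x) • v j = E.map c (val x • v i)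
    have hc := pos_eq_of_hom c
    rw [intervalRep_map_val]
    by_cases hi : a ≤ i.pos ∧ i.pos < b
    · obtain ⟨p⟩ := exists_path (i := t) (j := i) (by omega)
      rw [hv p, hv (p.cons c), pathMap_cons, LinearMap.comp_apply, map_smul]
      split_ifs with hj
      · rfl
      · have := hea j (p.cons c) (by omega)
        rw [pathMap_cons, LinearMap.comp_apply] at this
        rw [this, smul_zero, smul_zero]
    · rw [intervalRep_val_eq_zero x hi]
      simp
  · intro i x
    change g.app i (val x • v i) = x
    apply intervalRep_ext
    rw [map_smul, map_smul]
    by_cases hi : a ≤ i.pos ∧ i.pos < b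
    · obtain ⟨p⟩ := exists_path (i := t) (j := i) (by omega)
      rw [hv p, g.app_pathMap, intervalRep_pathMap_val, if_pos hi, he, smul_eq_mul, mul_one]
    · rw [intervalRep_val_eq_zero x hi, zero_smul]

theorem intervalRep_extVanishes_intervalRep {c d : ℕ} (hab : a < b) (hb : b ≤ m)
    (h : ¬ (c < a ∧ a ≤ d ∧ d < b)) :
    (intervalRep K m a b).ExtVanishes (intervalRep K m c d) := by
  refine intervalRep_extVanishes hab hb _ fun i j p hi hj y => ?_
  by_cases hjc : c ≤ j.pos ∧ j.pos < d
  · refine ⟨ofVal (by omega) (val y), intervalRep_ext ?_⟩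
    rw [intervalRep_pathMap_val, if_pos hjc, val_ofVal]
  · refine ⟨0, intervalRep_ext ?_⟩
    rw [intervalRep_val_eq_zero y hjc, map_zero, map_zero]

/-- On [a, b) the arrows k + 1 → k act injectively, so the dimensions w of a subrepresentation
decrease with position. The pairing is w(e − 1) − w(s − 1); if e − 1 lies in [a, b), non-separation
forces a < s, so both positions lie in [a, b). -/
theorem gVector_mem_domain (hab : a < b) (hb : b ≤ m) (v : ClusterIndec (LinearA m))
    (hv : InTube (tube v) a ↔ InTube (tube v) b) :
    gVector v ∈ (intervalRep K m a b).domain := by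
  obtain ⟨h1, h2, h3⟩ := isTube_tube v
  constructor
  · simp only [intervalRep_finrank]
    exact (sum_gVector_mul_indicator_eq_zero_iff hab hb v).2 hv
  · intro A
    rw [sum_gVector_mul v (fun i => (Module.finrank K (A.carrier i) : ℝ))]
    set w : ℕ → ℝ := extend fun i => (Module.finrank K (A.carrier i) : ℝ) with hw
    have hw0 : ∀ k, 0 ≤ w k := by
      intro k
      simp only [hw, extend]
      split_ifs <;> simp
    have hout : ∀ k, ¬ (a ≤ k ∧ k < b) → w k = 0 := by
      intro k hk
      simp only [hw, extend]
      split_ifs with hkm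
      · have : A.carrier (vertex k hkm) = ⊥ := by
          rw [eq_bot_iff]
          intro x _
          rw [Submodule.mem_bot]
          exact intervalRep_ext ((intervalRep_val_eq_zero x hk).trans (map_zero _).symm)
        rw [this]
        simp
      · rfl
    have hstep : ∀ k, a ≤ k → k + 1 < b → w (k + 1) ≤ w k := by
      intro k hak hkb
      have hk : k + 1 < m := by omega
      have hk' : k < m := by omega
      simp only [hw, extend, hk, hk', dif_pos, Nat.cast_le]
      let φ := (intervalRep K m a b).map (arrow (i := vertex (k + 1) hk) (j := vertex k hk') rfl)
      have hφ : ∀ x ∈ A.carrier (vertex (k + 1) hk), φ x ∈ A.carrier (vertex k hk') :=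
        fun x hx => A.map_mem _ x hx
      refine LinearMap.finrank_le_finrank_of_injective (f := φ.restrict hφ) ?_
      intro x y hxy
      have h := congrArg (fun z => val z.1) hxy
      simp only [LinearMap.coe_restrict_apply, φ] at h
      rw [intervalRep_map_val, intervalRep_map_val, if_pos (by simp; omega),
        if_pos (by simp; omega)] at h
      exact Subtype.ext (intervalRep_ext h)
    have hanti : ∀ k l, a ≤ k → k ≤ l → l < b → w l ≤ w k := by
      intro k l hak hkl
      induction l, hkl using Nat.le_induction with
      | base => exact fun _ => le_rfl
      | succ l hkl ih => exact fun hl => (hstep l (by omega) hl).trans (ih (by omega))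
    by_cases he : a ≤ (tube v).2 - 1 ∧ (tube v).2 - 1 < b
    · have hs : a < (tube v).1 := by
        unfold InTube at hv
        omega
      rw [if_neg (by omega)]
      have := hanti ((tube v).1 - 1) ((tube v).2 - 1) (by omega) (by omega) he.2
      linarith
    · rw [hout _ he]
      split_ifs
      · simp
      · linarith [hw0 ((tube v).1 - 1)]

end IntervalRep

/-! ### Arbitrary indecomposables with interval dimension vector. -/

section Indec

variable {K : Type u} [Field K] {m a b : ℕ} {M : QuiverRep K (LinearA m)}

theorem IsIndecWithDim.finrank_eq_one (hM : M.IsIndecWithDim (indicator m a b)) {i : LinearA m}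
    (hi : a ≤ i.pos ∧ i.pos < b) : Module.finrank K (M.space i) = 1 := by
  rw [(hM.2 i).2, indicator, if_pos hi]

theorem IsIndecWithDim.exists_ne_zero (hM : M.IsIndecWithDim (indicator m a b)) {i : LinearA m}
    (hi : a ≤ i.pos ∧ i.pos < b) : ∃ x : M.space i, x ≠ 0 := by
  have := hM.finrank_eq_one hi
  have : Nontrivial (M.space i) := Module.nontrivial_of_finrank_pos (R := K) (by omega)
  exact exists_ne 0

theorem IsIndecWithDim.eq_zero (hM : M.IsIndecWithDim (indicator m a b)) {i : LinearA m}
    (hi : ¬ (a ≤ i.pos ∧ i.pos < b)) (x : M.space i) : x = 0 := by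
  have h := hM.2 i
  rw [indicator, if_neg hi] at h
  have := h.1
  have := Module.finrank_zero_iff.1 h.2
  exact Subsingleton.elim _ _

/-- Inside the support all spaces are lines, so a map that is not surjective is zero, and cutting
the support at that arrow decomposes M. -/
theorem IsIndecWithDim.map_surjective (hM : M.IsIndecWithDim (indicator m a b)) {i j : LinearA m}
    (f : i ⟶ j) (hj : a ≤ j.pos) (hi : i.pos < b) : Function.Surjective (M.map f) := by
  have hf := pos_eq_of_hom f
  by_contra hsurj
  have hzero : ∀ x, M.map f x = 0 := by
    by_contra! h
    obtain ⟨x, hx⟩ := h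
    refine hsurj fun y => ?_
    obtain ⟨c, hc⟩ := (finrank_eq_one_iff_of_nonzero' _ hx).1
      (hM.finrank_eq_one (i := j) (by omega)) y
    exact ⟨c • x, by rw [map_smul, hc]⟩
  let A : M.Sub := ⟨fun k => if k.pos ≤ j.pos then ⊤ else ⊥, by
    intro k l g x hx
    have := pos_eq_of_hom g
    split_ifs at hx ⊢ with h1 h2 h2
    · trivial
    · trivial
    · omega
    · rw [(Submodule.mem_bot K).1 hx, map_zero]
      exact Submodule.zero_mem _⟩
  let B : M.Sub := ⟨fun k => if k.pos ≤ j.pos then ⊥ else ⊤, by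
    intro k l g x hx
    have := pos_eq_of_hom g
    split_ifs at hx ⊢ with h1 h2 h2
    · rw [(Submodule.mem_bot K).1 hx, map_zero]
      exact Submodule.zero_mem _
    · obtain rfl : l = j := pos_injective (by omega)
      obtain rfl : k = i := pos_injective (by omega)
      rw [Subsingleton.elim g f, hzero]
      exact Submodule.zero_mem _
    · omega
    · trivial⟩
  rcases hM.1.2 A B (fun k => by
    simp only [A, B]
    split_ifs
    · exact isCompl_top_bot
    · exact isCompl_bot_top) with h | h
  · obtain ⟨x, hx⟩ := hM.exists_ne_zero (i := j) (by omega)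
    have := h j
    simp only [A, le_refl, if_true] at this
    exact hx ((Submodule.mem_bot K).1 (this ▸ Submodule.mem_top (x := x)))
  · obtain ⟨x, hx⟩ := hM.exists_ne_zero (i := i) (by omega)
    have := h i
    simp only [B, hf, Nat.not_succ_le_self, if_false] at this
    exact hx ((Submodule.mem_bot K).1 (this ▸ Submodule.mem_top (x := x)))

/-- The extension of `M` by `N` given by linear maps `M_i → N_j` for all arrows `i ⟶ j`. -/
def extension (M N : QuiverRep K (LinearA m))
    (δ : ∀ i j : LinearA m, M.space i →ₗ[K] N.space j) : QuiverRep K (LinearA m) where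
  space i := N.space i × M.space i
  map {i j} f := LinearMap.prod (N.map f ∘ₗ LinearMap.fst K _ _ + δ i j ∘ₗ LinearMap.snd K _ _)
    (M.map f ∘ₗ LinearMap.snd K _ _)

/-- M and N are glued by a nonzero map M_a → N_{a-1}. The N-component of a splitting vanishes at d,
where N is zero, hence on all of [a, d] by surjectivity of the maps of M; at the arrow a → a − 1
this contradicts the gluing map. -/
theorem IsIndecWithDim.not_extVanishes {N : QuiverRep K (LinearA m)} {c d : ℕ}
    (hM : M.IsIndecWithDim (indicator m a b)) (hN : N.IsIndecWithDim (indicator m c d))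
    (hb : b ≤ m) (hca : c < a) (had : a ≤ d) (hdb : d < b) : ¬ M.ExtVanishes N := by
  classical
  have hδ : ∀ i j : LinearA m, ∃ δ : M.space i →ₗ[K] N.space j, i.pos = a → j.pos + 1 = a →
      ∃ x, δ x ≠ 0 := by
    intro i j
    by_cases h : i.pos = a ∧ j.pos + 1 = a
    · obtain ⟨y, hy⟩ := hN.exists_ne_zero (i := j) (by omega)
      obtain ⟨x, hx⟩ := hM.exists_ne_zero (i := i) (by omega)
      obtain ⟨φ, hφ⟩ := Module.Projective.exists_dual_ne_zero K hx
      exact ⟨LinearMap.toSpanSingleton K _ y ∘ₗ φ, fun _ _ => ⟨x, by simp [hφ, hy]⟩⟩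
    · exact ⟨0, fun h1 h2 => absurd ⟨h1, h2⟩ h⟩
  choose δ₀ hδ₀ using hδ
  let δ : ∀ i j : LinearA m, M.space i →ₗ[K] N.space j := fun i j =>
    if i.pos = a then δ₀ i j else 0
  intro hext
  obtain ⟨s, hs⟩ := hext (extension M N δ)
    ⟨fun i => LinearMap.inl K _ _, fun {i j} f x => Prod.ext
      (by change N.map f x = N.map f x + δ i j 0; simp) (by change 0 = M.map f 0; simp)⟩
    ⟨fun i => LinearMap.snd K _ _, fun f x => rfl⟩
    (fun i => LinearMap.inl_injective) (fun i => LinearMap.snd_surjective)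
    (fun i => LinearMap.range_inl K _ _)
  have hcomm : ∀ {i j : LinearA m} (f : i ⟶ j) (x : M.space i),
      (s.app j (M.map f x)).1 = N.map f (s.app i x).1 + δ i j x := by
    intro i j f x
    have h1 := congrArg Prod.fst (s.comm f x)
    have h2 : (s.app i x).2 = x := hs i x
    rw [h1]
    change N.map f (s.app i x).1 + δ i j (s.app i x).2 = _
    rw [h2]
  -- Downward induction on the position, starting at d.
  have hvan : ∀ k, a + k ≤ d → ∀ i : LinearA m, i.pos + k = d → ∀ x : M.space i,
      (s.app i x).1 = 0 := by
    intro k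
    induction k with
    | zero => exact fun _ i hi x => hN.eq_zero (by omega) _
    | succ k ih =>
      intro hk i hi x
      have hi' : i.pos + 1 < m := by omega
      let f : (vertex (i.pos + 1) hi' : LinearA m) ⟶ i := arrow rfl
      obtain ⟨y, rfl⟩ := hM.map_surjective f (by omega) (by simp; omega) x
      rw [hcomm, ih (by omega) _ (by simp; omega), map_zero, zero_add,
        show δ (vertex (i.pos + 1) hi') i = 0 from if_neg (by simp; omega), LinearMap.zero_apply]
  obtain ⟨x, hx⟩ := hδ₀ (vertex a (by omega)) (vertex (a - 1) (by omega)) rfl (by simp; omega)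
  apply hx
  have h := hcomm
    (arrow (i := vertex a (by omega)) (j := vertex (a - 1) (by omega)) (by simp; omega)) x
  rw [hvan (d - a) (by omega) (vertex a (by omega)) (by simp; omega), map_zero, zero_add,
    hM.eq_zero (by simp; omega) (M.map _ x), map_zero,
    show δ (vertex a (by omega)) (vertex (a - 1) (by omega)) = δ₀ _ _ from if_pos rfl] at h
  exact h.symm

theorem IsIndecWithDim.homVanishes_proj_iff (hM : M.IsIndecWithDim (indicator m a b))
    (i : LinearA m) : (proj K i).HomVanishes M ↔ ¬ (a ≤ i.pos ∧ i.pos < b) := by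
  rw [QuiverRep.homVanishes_proj_iff]
  constructor
  · intro h hi
    obtain ⟨x, hx⟩ := hM.exists_ne_zero hi
    exact hx (h x)
  · exact fun hi => hM.eq_zero hi

end Indec

end QuiverRep

/-! ### Ext-orthogonality in terms of tubes. -/

/-- Two intervals are nested, or disjoint and not adjacent. -/
def Compat (I J : ℕ × ℕ) : Prop :=
  (I.1 ≤ J.1 ∧ J.2 ≤ I.2) ∨ (J.1 ≤ I.1 ∧ I.2 ≤ J.2) ∨ I.2 < J.1 ∨ J.2 < I.1

open QuiverRep in
-- Incompatible supports mean c < a ≤ d < b up to exchange, exactly the case of nonzero Ext.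
-- Orthogonality is stated with unspecified representatives, so one direction treats arbitrary
-- indecomposables, while the other only exhibits `intervalRep`.
theorem extOrthogonal_iff (K : Type u) [Field K] {m : ℕ} (u v : ClusterIndec (LinearA m)) :
    ExtOrthogonal K u v ↔ Compat (tube u) (tube v) := by
  have key : ∀ (α : PosRoot (LinearA m)) (i : LinearA m),
      (∃ M : QuiverRep K (LinearA m), M.IsIndecWithDim α.1 ∧ (proj K i).HomVanishes M) ↔
        Compat (tube (Sum.inl α)) (tube (Sum.inr i)) := by
    intro α i
    have h1 := tube_inl_fst_lt α
    have h2 := tube_inl_snd_le α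
    have hi := i.pos_lt
    have h : Compat (tube (Sum.inl α)) (tube (Sum.inr i)) ↔
        ¬ ((tube (Sum.inl α)).1 ≤ i.pos ∧ i.pos < (tube (Sum.inl α)).2) := by
      unfold Compat
      rw [show tube (Sum.inr i) = (i.pos + 1, m + 1) from rfl]
      omega
    rw [h, root_eq_indicator]
    constructor
    · rintro ⟨M, hM, hv⟩
      exact (hM.homVanishes_proj_iff i).1 hv
    · intro hi
      have hM := intervalRep_isIndecWithDim (K := K) h1 h2
      exact ⟨_, hM, (hM.homVanishes_proj_iff i).2 hi⟩
  rcases u with α | i <;> rcases v with β | j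
  · have h1 := tube_inl_fst_lt α
    have h2 := tube_inl_snd_le α
    have h3 := tube_inl_fst_lt β
    have h4 := tube_inl_snd_le β
    simp only [ExtOrthogonal]
    rw [root_eq_indicator α, root_eq_indicator β]
    unfold Compat
    constructor
    · rintro ⟨M, N, hM, hN, hMN, hNM⟩
      by_contra hc
      by_cases hlt : (tube (Sum.inl β)).1 < (tube (Sum.inl α)).1
      · exact hM.not_extVanishes hN h2 hlt (by omega) (by omega) hMN
      · exact hN.not_extVanishes hM h4 (by omega) (by omega) (by omega) hNM
    · intro hc
      exact ⟨_, _, intervalRep_isIndecWithDim h1 h2, intervalRep_isIndecWithDim h3 h4,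
        intervalRep_extVanishes_intervalRep h1 h2 (by omega),
        intervalRep_extVanishes_intervalRep h3 h4 (by omega)⟩
  · exact key α j
  · refine (key β i).trans ?_
    unfold Compat
    omega
  · simp only [ExtOrthogonal, Compat, tube, true_iff]
    omega

/-! ### Tubings and the points they separate. -/

/-- A family of pairwise compatible intervals in `[0, N)` that contains `[0, N)`. -/
structure IsTubing (N : ℕ) (F : Finset (ℕ × ℕ)) : Prop where
  full : (0, N) ∈ F
  bounds : ∀ I ∈ F, I.1 < I.2 ∧ I.2 ≤ N
  compat : ∀ I ∈ F, ∀ J ∈ F, Compat I J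

/-- No interval of the family separates `x` from `y`. -/
def Unseparated (F : Finset (ℕ × ℕ)) (x y : ℕ) : Prop := ∀ I ∈ F, InTube I x ↔ InTube I y

/-- The smallest interval of the family that contains `p` ends at `q`. -/
def Visible (F : Finset (ℕ × ℕ)) (p q : ℕ) : Prop :=
  ∃ s, (s, q) ∈ F ∧ InTube (s, q) p ∧ ∀ I ∈ F, InTube I p → I.1 ≤ s ∧ q ≤ I.2

namespace IsTubing

variable {N : ℕ} {F : Finset (ℕ × ℕ)}

/-- Each interval has a point lying in no smaller member. For I = [s, e) take the largest k < e with
[s, k) in F, or s if there is none: a smaller member through k would cross or touch [s, k). -/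
theorem exists_top (h : IsTubing N F) {I : ℕ × ℕ} (hI : I ∈ F) :
    ∃ c, InTube I c ∧ ∀ J ∈ F, InTube J c → J.1 ≤ I.1 ∧ I.2 ≤ J.2 := by
  classical
  obtain ⟨s, e⟩ := I
  have hse := h.bounds _ hI
  simp only at hse
  let P : ℕ → Prop := fun k => k = s ∨ ((s, k) ∈ F ∧ s < k ∧ k < e)
  have hP : P (Nat.findGreatest P e) := Nat.findGreatest_spec (P := P) hse.1.le (Or.inl rfl)
  set c := Nat.findGreatest P e
  have hmax : ∀ k, k < e → (s, k) ∈ F → s < k → k ≤ c := fun k hk hkF hs =>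
    Nat.le_findGreatest hk.le (Or.inr ⟨hkF, hs, hk⟩)
  refine ⟨c, ⟨?_, ?_⟩, ?_⟩
  · rcases hP with hP | hP <;> omega
  · rcases hP with hP | hP <;> omega
  · rintro ⟨x, y⟩ hJ hc
    have h1 := h.compat _ hI _ hJ
    simp only [Compat, InTube] at h1 hc ⊢
    by_cases hx : x = s
    · subst hx
      have h2 := h.bounds _ hJ
      have h3 : y < e → y ≤ c := fun hy => hmax y hy hJ h2.1
      omega
    · rcases hP with hP | ⟨hP, hP1, hP2⟩
      · omega
      · have h2 := h.compat _ hP _ hJ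
        simp only [Compat] at h2
        omega

/-- Choosing such a point for every member gives as many pairwise separated points as there are
intervals. Hence N intervals separate all points, and N − 1 intervals leave at most one unseparated
pair. -/
theorem exists_transversal (h : IsTubing N F) :
    ∃ S ⊆ Finset.range N, S.card = F.card ∧
      ∀ x ∈ S, ∀ y ∈ S, Unseparated F x y → x = y := by
  classical
  choose! σ hσ using fun I (hI : I ∈ F) => h.exists_top hI
  have key : ∀ I ∈ F, ∀ J ∈ F, Unseparated F (σ I) (σ J) → I = J := by
    intro I hI J hJ hu
    have h1 := (hσ I hI).2 J hJ ((hu J hJ).2 (hσ J hJ).1)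
    have h2 := (hσ J hJ).2 I hI ((hu I hI).1 (hσ I hI).1)
    ext <;> omega
  refine ⟨F.image σ, ?_, ?_, ?_⟩
  · intro x hx
    obtain ⟨I, hI, rfl⟩ := Finset.mem_image.1 hx
    have h1 := (hσ I hI).1
    have h2 := h.bounds I hI
    unfold InTube at h1
    rw [Finset.mem_range]
    omega
  · refine Finset.card_image_of_injOn fun I hI J hJ hIJ => key I hI J hJ ?_
    intro K _
    rw [hIJ]
  · intro x hx y hy hxy
    obtain ⟨I, hI, rfl⟩ := Finset.mem_image.1 hx
    obtain ⟨J, hJ, rfl⟩ := Finset.mem_image.1 hy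
    rw [key I hI J hJ hxy]

theorem eq_of_unseparated (h : IsTubing N F) (hcard : F.card = N) {x y : ℕ} (hx : x < N)
    (hy : y < N) (hxy : Unseparated F x y) : x = y := by
  obtain ⟨S, hS, hSc, hinj⟩ := h.exists_transversal
  have : S = Finset.range N := Finset.eq_of_subset_of_card_le hS (by simp [hSc, hcard])
  subst this
  exact hinj x (Finset.mem_range.2 hx) y (Finset.mem_range.2 hy) hxy

/-- The transversal misses a single point z, so every unseparated pair contains z; two different
pairs would by transitivity give a third one avoiding z. This makes the label of a wall unique. -/
theorem unseparated_unique (h : IsTubing N F) (hcard : F.card + 1 = N) {a b x y : ℕ} (ha : a < N)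
    (hb : b < N) (hab : a ≠ b) (hu : Unseparated F a b) (hx : x < N) (hy : y < N) (hxy : x ≠ y)
    (hu' : Unseparated F x y) : (x = a ∧ y = b) ∨ (x = b ∧ y = a) := by
  obtain ⟨S, hS, hSc, hinj⟩ := h.exists_transversal
  have hc : (Finset.range N \ S).card = 1 := by
    rw [Finset.card_sdiff_of_subset hS, Finset.card_range]
    omega
  obtain ⟨z, hz⟩ := Finset.card_eq_one.1 hc
  have key : ∀ x y, x < N → y < N → x ≠ y → Unseparated F x y → x = z ∨ y = z := by
    intro x y hx hy hne hxy
    by_contra! hcon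
    have hmem : ∀ w, w < N → w ≠ z → w ∈ S := by
      intro w hw hwz
      by_contra hwS
      have : w ∈ Finset.range N \ S := Finset.mem_sdiff.2 ⟨Finset.mem_range.2 hw, hwS⟩
      rw [hz, Finset.mem_singleton] at this
      exact hwz this
    exact hne (hinj x (hmem x hx hcon.1) y (hmem y hy hcon.2) hxy)
  have h1 := key a b ha hb hab hu
  have h2 := key x y hx hy hxy hu'
  by_contra hcon
  have symm : ∀ {x y}, Unseparated F x y → Unseparated F y x := fun h I hI => (h I hI).symm
  have trans : ∀ {x y w}, Unseparated F x y → Unseparated F y w → Unseparated F x w :=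
    fun h h' I hI => (h I hI).trans (h' I hI)
  rcases h1 with rfl | rfl <;> rcases h2 with rfl | rfl
  · have := key b y hb hy (by omega) (trans (symm hu) hu')
    omega
  · have := key b x hb hx (by omega) (trans (symm hu) (symm hu'))
    omega
  · have := key a y ha hy (by omega) (trans hu hu')
    omega
  · have := key a x ha hx (by omega) (trans hu (symm hu'))
    omega

theorem exists_min (h : IsTubing N F) {a : ℕ} (ha : a < N) :
    ∃ J ∈ F, InTube J a ∧ ∀ I ∈ F, InTube I a → I.1 ≤ J.1 ∧ J.2 ≤ I.2 := by
  classical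
  obtain ⟨J, hJ, hmin⟩ := Finset.exists_min_image (F.filter fun I => InTube I a)
    (fun I => I.2 - I.1) ⟨(0, N), by simp [h.full, InTube, ha]⟩
  simp only [Finset.mem_filter] at hJ hmin
  refine ⟨J, hJ.1, hJ.2, fun I hI hIa => ?_⟩
  have h1 := hmin I ⟨hI, hIa⟩
  have h2 := h.compat I hI J hJ.1
  have h3 := hJ.2
  simp only [Compat, InTube] at *
  omega

end IsTubing

/-! ### The two completions of a wall. -/

/-- A family of compatible intervals, one short of maximal, that does not separate `a` from `b`;
the smallest interval containing them is `J`. -/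
structure IsWall (N : ℕ) (F : Finset (ℕ × ℕ)) (a b : ℕ) (J : ℕ × ℕ) : Prop where
  tubing : IsTubing N F
  card : F.card + 1 = N
  lt : a < b
  lt_bound : b < N
  unsep : Unseparated F a b
  mem : J ∈ F
  left_mem : InTube J a
  min : ∀ I ∈ F, InTube I a → I.1 ≤ J.1 ∧ J.2 ≤ I.2

namespace IsWall

variable {N : ℕ} {F : Finset (ℕ × ℕ)} {a b : ℕ} {J : ℕ × ℕ}

theorem right_mem (h : IsWall N F a b J) : InTube J b := (h.unsep J h.mem).1 h.left_mem

theorem exists_sep (h : IsWall N F a b J) {x : ℕ} (hx : x < N) (hxa : x ≠ a) (hxb : x ≠ b) :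
    ∃ I ∈ F, ¬ (InTube I x ↔ InTube I a) := by
  by_contra! hcon
  have h1 := h.lt
  have h2 := h.lt_bound
  have := h.tubing.unseparated_unique h.card (by omega) h2 (by omega) h.unsep hx (by omega) hxa
    hcon
  omega

/-- If an end of u were elsewhere, the point just outside u at that end would be separated from a by
some member of F, and that member would be incompatible with u. -/
theorem eq_lower (h : IsWall N F a b J) {u : ℕ × ℕ} (hu : IsTubing N (insert u F))
    (ha : InTube u a) (hb : ¬ InTube u b) : u = (J.1, b) := by
  have h1 := h.lt
  have h2 := h.lt_bound
  have h3 := h.left_mem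
  have h4 := h.right_mem
  have hc : ∀ I ∈ F, Compat u I := fun I hI =>
    hu.compat u (Finset.mem_insert_self _ _) I (Finset.mem_insert_of_mem hI)
  have h5 := hc J h.mem
  simp only [InTube, Compat] at ha hb h3 h4 h5 hc
  have he : u.2 = b := by
    by_contra hne
    obtain ⟨I, hI, hsep⟩ := h.exists_sep (x := u.2) (by omega) (by omega) (by omega)
    have h6 := hc I hI
    have h7 := h.unsep I hI
    simp only [InTube] at hsep h7
    omega
  have hs : u.1 = J.1 := by
    by_contra hne
    obtain ⟨I, hI, hsep⟩ := h.exists_sep (x := u.1 - 1) (by omega) (by omega) (by omega)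
    have h6 := hc I hI
    have h7 := h.unsep I hI
    have h8 := h.min I hI
    simp only [InTube] at hsep h7 h8
    omega
  exact Prod.ext hs he

theorem eq_upper (h : IsWall N F a b J) {u : ℕ × ℕ} (hu : IsTubing N (insert u F))
    (ha : ¬ InTube u a) (hb : InTube u b) : u = (a + 1, J.2) := by
  have h1 := h.lt
  have h2 := h.lt_bound
  have h3 := h.left_mem
  have h4 := h.right_mem
  have h0 := h.tubing.bounds J h.mem
  have hc : ∀ I ∈ F, Compat u I := fun I hI =>
    hu.compat u (Finset.mem_insert_self _ _) I (Finset.mem_insert_of_mem hI)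
  have h5 := hc J h.mem
  simp only [InTube, Compat] at ha hb h3 h4 h5 hc
  have hs : u.1 = a + 1 := by
    by_contra hne
    obtain ⟨I, hI, hsep⟩ := h.exists_sep (x := u.1 - 1) (by omega) (by omega) (by omega)
    have h6 := hc I hI
    have h7 := h.unsep I hI
    simp only [InTube] at hsep h7
    omega
  have he : u.2 = J.2 := by
    by_contra hne
    obtain ⟨I, hI, hsep⟩ := h.exists_sep (x := u.2) (by omega) (by omega) (by omega)
    have h6 := hc I hI
    have h7 := h.unsep I hI
    have h8 := h.min I hI
    simp only [InTube] at hsep h7 h8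
    omega
  exact Prod.ext hs he

/-- When u contains p, a member of F separating p from a must contain p and lie inside u, so u is
never the smallest interval around p. -/
theorem visible_insert_iff (h : IsWall N F a b J) {u : ℕ × ℕ} (hu : IsTubing N (insert u F))
    (hsep : ¬ (InTube u a ↔ InTube u b)) {p q : ℕ} (hp : p < N) (hpa : p ≠ a) (hpb : p ≠ b) :
    Visible (insert u F) p q ↔ Visible F p q := by
  have h3 := h.left_mem
  have h4 := h.right_mem
  have hc : ∀ I ∈ F, Compat u I := fun I hI =>
    hu.compat u (Finset.mem_insert_self _ _) I (Finset.mem_insert_of_mem hI)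
  have key : InTube u p → ∃ K ∈ F, InTube K p ∧ ¬ InTube K a ∧ u.1 ≤ K.1 ∧ K.2 ≤ u.2 := by
    intro hup
    obtain ⟨K, hK, hKs⟩ := h.exists_sep hp hpa hpb
    have h5 := hc J h.mem
    have h6 := hc K hK
    have h7 := h.unsep K hK
    have h8 := h.min K hK
    simp only [InTube, Compat] at *
    refine ⟨K, hK, ?_⟩
    omega
  constructor
  · rintro ⟨s, hs, hsp, hmin⟩
    rcases Finset.mem_insert.1 hs with rfl | hs
    · obtain ⟨K, hK, hKp, hKa, h5, h6⟩ := key hsp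
      have h7 := hmin K (Finset.mem_insert_of_mem hK) hKp
      have h8 := h.unsep K hK
      clear key
      simp only [InTube] at *
      omega
    · exact ⟨s, hs, hsp, fun I hI => hmin I (Finset.mem_insert_of_mem hI)⟩
  · rintro ⟨s, hs, hsp, hmin⟩
    refine ⟨s, Finset.mem_insert_of_mem hs, hsp, fun I hI hIp => ?_⟩
    rcases Finset.mem_insert.1 hI with rfl | hI
    · obtain ⟨K, hK, hKp, hKa, h5, h6⟩ := key hIp
      have := hmin K hK hKp
      omega
    · exact hmin I hI hIp

theorem visible_insert_upper_left (h : IsWall N F a b J) (q : ℕ) :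
    Visible (insert (a + 1, J.2) F) a q ↔ q = J.2 := by
  have h3 := h.left_mem
  constructor
  · rintro ⟨s, hs, hsp, hmin⟩
    have h5 := hmin J (Finset.mem_insert_of_mem h.mem) h3
    rcases Finset.mem_insert.1 hs with hs | hs
    · exact (Prod.ext_iff.1 hs).2
    · have := h.min _ hs hsp
      simp only at this
      omega
  · rintro rfl
    refine ⟨J.1, Finset.mem_insert_of_mem h.mem, h3, fun I hI hIa => ?_⟩
    rcases Finset.mem_insert.1 hI with rfl | hI
    · simp only [InTube] at hIa
      omega
    · exact h.min I hI hIa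

theorem visible_insert_upper_right (h : IsWall N F a b J) (q : ℕ) :
    Visible (insert (a + 1, J.2) F) b q ↔ q = J.2 := by
  have h1 := h.lt
  have h3 := h.left_mem
  have h4 := h.right_mem
  constructor
  · rintro ⟨s, hs, hsp, hmin⟩
    have h5 := hmin (a + 1, J.2) (Finset.mem_insert_self _ _)
    rcases Finset.mem_insert.1 hs with hs | hs
    · exact (Prod.ext_iff.1 hs).2
    · have h6 := h.min _ hs ((h.unsep _ hs).2 hsp)
      simp only [InTube] at *
      omega
  · rintro rfl
    refine ⟨a + 1, Finset.mem_insert_self _ _, ⟨h1, h4.2⟩, fun I hI hIb => ?_⟩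
    rcases Finset.mem_insert.1 hI with rfl | hI
    · exact ⟨le_rfl, le_rfl⟩
    · have := h.min I hI ((h.unsep I hI).2 hIb)
      simp only [InTube] at *
      omega

theorem visible_insert_lower_left (h : IsWall N F a b J) (q : ℕ) :
    Visible (insert (J.1, b) F) a q ↔ q = b := by
  have h1 := h.lt
  have h3 := h.left_mem
  have h4 := h.right_mem
  constructor
  · rintro ⟨s, hs, hsp, hmin⟩
    have h5 := hmin (J.1, b) (Finset.mem_insert_self _ _)
    rcases Finset.mem_insert.1 hs with hs | hs
    · exact (Prod.ext_iff.1 hs).2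
    · have h6 := h.min _ hs hsp
      simp only [InTube] at *
      omega
  · rintro rfl
    refine ⟨J.1, Finset.mem_insert_self _ _, ⟨h3.1, h1⟩, fun I hI hIa => ?_⟩
    rcases Finset.mem_insert.1 hI with rfl | hI
    · exact ⟨le_rfl, le_rfl⟩
    · have := h.min I hI hIa
      simp only [InTube] at *
      omega

theorem visible_insert_lower_right (h : IsWall N F a b J) (q : ℕ) :
    Visible (insert (J.1, b) F) b q ↔ q = J.2 := by
  have h1 := h.lt
  have h3 := h.left_mem
  have h4 := h.right_mem
  constructor
  · rintro ⟨s, hs, hsp, hmin⟩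
    have h5 := hmin J (Finset.mem_insert_of_mem h.mem) h4
    rcases Finset.mem_insert.1 hs with hs | hs
    · have hqb : q = b := (Prod.ext_iff.1 hs).2
      have hbq : b < q := hsp.2
      omega
    · have h6 := h.min _ hs ((h.unsep _ hs).2 hsp)
      simp only [InTube] at *
      omega
  · rintro rfl
    refine ⟨J.1, Finset.mem_insert_of_mem h.mem, h4, fun I hI hIb => ?_⟩
    rcases Finset.mem_insert.1 hI with rfl | hI
    · simp only [InTube] at hIb
      omega
    · exact h.min I hI ((h.unsep I hI).2 hIb)

theorem lt_of_visible (h : IsWall N F a b J) {p : ℕ} (hp : Visible F p b) :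
    a < p := by
  obtain ⟨s, hs, hsp, -⟩ := hp
  have h1 := h.lt
  have h2 := h.unsep _ hs
  simp only [InTube] at *
  omega

theorem not_between_of_visible (h : IsWall N F a b J) {p q : ℕ} (hq : b < q)
    (hp : Visible F p q) : p ≤ a ∨ b ≤ p := by
  obtain ⟨s, hs, hsp, hmin⟩ := hp
  have h1 := h.lt
  have h2 := h.unsep _ hs
  have h3 := h.left_mem
  have h4 := h.right_mem
  have h0 := h.lt_bound
  by_contra hcon
  obtain ⟨K, hK, hKs⟩ := h.exists_sep (x := p) (by omega) (by omega) (by omega)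
  have h5 := hmin K hK
  have h6 := h.min K hK
  have h7 := h.min _ hs
  simp only [InTube] at *
  omega

end IsWall

/-! ### The potential and its change across a wall. -/

section Potential

variable {G : Type*} [Group G] (x : ℕ → ℕ → G)

open Classical in
/-- The product of the `x p q` for the `p < k` with `V p q`, in decreasing order of `p`. -/
noncomputable def rowProd (V : ℕ → ℕ → Prop) (q : ℕ) : ℕ → G
  | 0 => 1
  | p + 1 => (if V p q then x p q else 1) * rowProd V q p

/-- The product of the rows, in increasing order. -/
noncomputable def potential (V : ℕ → ℕ → Prop) : ℕ → G
  | 0 => 1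
  | q + 1 => potential V q * rowProd x V q q

/-- The relations of the Stasheff group on `N` strands. -/
structure StasheffFamily (N : ℕ) : Prop where
  comm : ∀ i j k, i < j → j < k → k < N → x i j * x j k = x j k * x i k * x i j
  disjoint : ∀ i j k l, i < j → j < k → k < l → l < N → Commute (x i j) (x k l)
  nested : ∀ i j k l, i < j → j < k → k < l → l < N → Commute (x j k) (x i l)

variable {x}

theorem rowProd_congr {V V' : ℕ → ℕ → Prop} {q k : ℕ} (h : ∀ p < k, (V p q ↔ V' p q)) :
    rowProd x V q k = rowProd x V' q k := by
  classical
  induction k with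
  | zero => rfl
  | succ k ih =>
    rw [rowProd, rowProd, if_congr (h k (Nat.lt_succ_self k)) rfl rfl,
      ih fun p hp => h p (by omega)]

theorem potential_congr {V V' : ℕ → ℕ → Prop} {k : ℕ}
    (h : ∀ p q, p < q → q < k → (V p q ↔ V' p q)) :
    potential x V k = potential x V' k := by
  induction k with
  | zero => rfl
  | succ k ih =>
    rw [potential, potential, ih fun p q hp hq => h p q hp (by omega),
      rowProd_congr fun p hp => h p k hp (by omega)]

theorem rowProd_eq_one {V : ℕ → ℕ → Prop} {q k : ℕ} (h : ∀ p < k, ¬ V p q) :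
    rowProd x V q k = 1 := by
  induction k with
  | zero => rfl
  | succ k ih =>
    rw [rowProd, if_neg (h k (by omega)), one_mul, ih fun p hp => h p (by omega)]

theorem commute_rowProd {V : ℕ → ℕ → Prop} {q k : ℕ} {g : G}
    (h : ∀ p < k, V p q → Commute g (x p q)) : Commute g (rowProd x V q k) := by
  induction k with
  | zero => exact Commute.one_right g
  | succ k ih =>
    rw [rowProd]
    refine Commute.mul_right ?_ (ih fun p hp => h p (by omega))
    split_ifs with hV
    · exact h k (by omega) hV
    · exact Commute.one_right g

/-- The change of the data `V p q` when the wall `(a, b)` is crossed. -/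
structure Crossing (N a b t : ℕ) (V V' : ℕ → ℕ → Prop) : Prop where
  lt : a < b
  lt_bound : b < N
  lt_top : b < t
  iff : ∀ p q, p < N → p ≠ a → p ≠ b → (V p q ↔ V' p q)
  left : ∀ q, V a q ↔ q = t
  right : ∀ q, V b q ↔ q = t
  left' : ∀ q, V' a q ↔ q = b
  right' : ∀ q, V' b q ↔ q = t
  above : ∀ p, p ≠ a → p < b → V p b → a < p
  outside : ∀ p q, b < q → p < q → q < N → V p q → p ≤ a ∨ b ≤ p

variable {N a b t : ℕ} {V V' : ℕ → ℕ → Prop}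

/-- Every other factor x p b of row b has p > a. As rows are ordered by decreasing p, the new factor
x a b appears at the right end. -/
theorem Crossing.rowProd_wall (h : Crossing N a b t V V') :
    rowProd x V' b b = rowProd x V b b * x a b := by
  classical
  have h1 := h.lt
  have h2 := h.lt_bound
  have h3 := h.lt_top
  suffices ∀ d, a + 1 + d ≤ b →
      rowProd x V' b (a + 1 + d) = rowProd x V b (a + 1 + d) * x a b by
    have := this (b - (a + 1)) (by omega)
    rwa [show a + 1 + (b - (a + 1)) = b by omega] at this
  intro d
  induction d with
  | zero =>
    intro _
    have hV : ∀ p < a, ¬ V p b := fun p hp hVp => by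
      have := h.above p (by omega) (by omega) hVp
      omega
    have hV' : ∀ p < a, ¬ V' p b := fun p hp hVp =>
      hV p hp ((h.iff p b (by omega) (by omega) (by omega)).2 hVp)
    rw [Nat.add_zero, rowProd, rowProd, rowProd_eq_one hV, rowProd_eq_one hV',
      if_pos ((h.left' b).2 rfl), if_neg (by rw [h.left]; omega)]
    simp
  | succ d ih =>
    intro hd
    rw [← Nat.add_assoc, rowProd, rowProd, ih (by omega),
      if_congr (h.iff (a + 1 + d) b (by omega) (by omega) (by omega)) rfl rfl, mul_assoc]

/-- In row q > b every p satisfies p ≤ a or b ≤ p, so x a b commutes with all factors except those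
with p = a or p = b, which occur only for q = t. There x a t stands directly after x b t, and x_ab
x_bt = x_bt x_at x_ab exchanges the two versions of the row. -/
theorem Crossing.rowProd_beyond (h : Crossing N a b t V V') (hx : StasheffFamily x N) {q : ℕ}
    (hbq : b < q) (hqN : q < N) :
    x a b * rowProd x V' q q = rowProd x V q q * x a b := by
  classical
  have h1 := h.lt
  have h2 := h.lt_bound
  have hcomm : ∀ p, p < q → p ≠ a → p ≠ b → V' p q → Commute (x a b) (x p q) := by
    intro p hp hpa hpb hV
    have := h.outside p q hbq hp hqN ((h.iff p q (by omega) hpa hpb).2 hV)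
    by_cases hlt : p < a
    · exact hx.nested p a b q hlt h1 hbq hqN
    · exact hx.disjoint a b p q h1 (by omega) hp hqN
  by_cases hqt : q = t
  · subst hqt
    have hlow : rowProd x V q a = rowProd x V' q a :=
      rowProd_congr fun p hp => h.iff p q (by omega) (by omega) (by omega)
    have hmid : ∀ d, a + 1 + d ≤ b →
        rowProd x V q (a + 1 + d) = x a q * rowProd x V' q (a + 1 + d) := by
      intro d
      induction d with
      | zero =>
        intro _
        rw [Nat.add_zero, rowProd, rowProd, if_pos ((h.left q).2 rfl),
          if_neg (by rw [h.left']; omega), one_mul, hlow]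
      | succ d ih =>
        intro hd
        have hV : ¬ V (a + 1 + d) q := fun hV => by
          have := h.outside _ _ hbq (by omega) hqN hV
          omega
        have hV' : ¬ V' (a + 1 + d) q := fun hV' =>
          hV ((h.iff _ _ (by omega) (by omega) (by omega)).2 hV')
        rw [← Nat.add_assoc, rowProd, rowProd, if_neg hV, if_neg hV', one_mul, one_mul,
          ih (by omega)]
    have hmid' := hmid (b - (a + 1)) (by omega)
    rw [show a + 1 + (b - (a + 1)) = b by omega] at hmid'
    have hcb : Commute (x a b) (rowProd x V' q b) := commute_rowProd fun p hp hV => by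
      by_cases hpa : p = a
      · subst hpa
        rw [h.left'] at hV
        omega
      · exact hcomm p (by omega) hpa (by omega) hV
    suffices ∀ d, b + 1 + d ≤ q →
        x a b * rowProd x V' q (b + 1 + d) = rowProd x V q (b + 1 + d) * x a b by
      have := this (q - (b + 1)) (by omega)
      rwa [show b + 1 + (q - (b + 1)) = q by omega] at this
    intro d
    induction d with
    | zero =>
      intro _
      rw [Nat.add_zero, rowProd, rowProd, if_pos ((h.right q).2 rfl),
        if_pos ((h.right' q).2 rfl), hmid', ← mul_assoc, hx.comm a b q h1 hbq hqN]
      simp only [mul_assoc, hcb.eq]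
    | succ d ih =>
      intro hd
      rw [← Nat.add_assoc, rowProd, rowProd, mul_assoc, ← ih (by omega),
        if_congr (h.iff (b + 1 + d) q (by omega) (by omega) (by omega)) rfl rfl]
      split_ifs with hV
      · rw [← mul_assoc, (hcomm _ (by omega) (by omega) (by omega) hV).eq, mul_assoc]
      · simp
  · have hVV : ∀ p < q, (V p q ↔ V' p q) := by
      intro p hp
      by_cases hpa : p = a
      · subst hpa
        rw [h.left, h.left']
        omega
      · by_cases hpb : p = b
        · subst hpb
          rw [h.right, h.right']
        · exact h.iff p q (by omega) hpa hpb
    rw [rowProd_congr hVV]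
    refine (commute_rowProd fun p hp hV => ?_).eq
    by_cases hpa : p = a
    · subst hpa
      rw [h.left'] at hV
      omega
    · by_cases hpb : p = b
      · subst hpb
        rw [h.right'] at hV
        omega
      · exact hcomm p hp hpa hpb hV

/-- The factor x a b created in row b is pushed right through all later rows. If t = N there is no
row t, and only commutations are used. -/
theorem Crossing.potential_eq (h : Crossing N a b t V V') (hx : StasheffFamily x N) :
    potential x V' N = potential x V N * x a b := by
  have h1 := h.lt
  have h2 := h.lt_bound
  have h3 := h.lt_top
  suffices ∀ d, b + 1 + d ≤ N →
      potential x V' (b + 1 + d) = potential x V (b + 1 + d) * x a b by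
    have := this (N - (b + 1)) (by omega)
    rwa [show b + 1 + (N - (b + 1)) = N by omega] at this
  intro d
  induction d with
  | zero =>
    intro _
    rw [Nat.add_zero, potential, potential, h.rowProd_wall, ← mul_assoc]
    congr 2
    refine potential_congr fun p q hp hq => ?_
    by_cases hpa : p = a
    · subst hpa
      rw [h.left, h.left']
      omega
    · exact (h.iff p q (by omega) hpa (by omega)).symm
  | succ d ih =>
    intro hd
    rw [← Nat.add_assoc, potential, potential, ih (by omega), mul_assoc,
      h.rowProd_beyond hx (by omega) (by omega), mul_assoc]

end Potential

theorem IsWall.crossing {N a b : ℕ} {F : Finset (ℕ × ℕ)} {J : ℕ × ℕ} (h : IsWall N F a b J)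
    (hl : IsTubing N (insert (J.1, b) F)) (hu : IsTubing N (insert (a + 1, J.2) F)) :
    Crossing N a b J.2 (Visible (insert (a + 1, J.2) F)) (Visible (insert (J.1, b) F)) := by
  have h1 := h.lt
  have h3 := h.left_mem
  have h4 := h.right_mem
  have hus : ¬ (InTube (a + 1, J.2) a ↔ InTube (a + 1, J.2) b) := by
    simp only [InTube] at *
    omega
  have hls : ¬ (InTube (J.1, b) a ↔ InTube (J.1, b) b) := by
    simp only [InTube] at *
    omega
  refine ⟨h1, h.lt_bound, h4.2, ?_, h.visible_insert_upper_left, h.visible_insert_upper_right,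
    h.visible_insert_lower_left, h.visible_insert_lower_right, ?_, ?_⟩
  · intro p q hp hpa hpb
    rw [h.visible_insert_iff hu hus hp hpa hpb, h.visible_insert_iff hl hls hp hpa hpb]
  · intro p hpa hpb hV
    rw [h.visible_insert_iff hu hus (hpb.trans h.lt_bound) hpa (by omega)] at hV
    exact h.lt_of_visible hV
  · intro p q hbq hpq hqN hV
    by_cases hpa : p = a
    · omega
    · by_cases hpb : p = b
      · omega
      · rw [h.visible_insert_iff hu hus (by omega) hpa hpb] at hV
        exact h.not_between_of_visible hbq hV

theorem potential_insert {G : Type*} [Group G] {x : ℕ → ℕ → G} {N a b : ℕ}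
    {F : Finset (ℕ × ℕ)} {u u' : ℕ × ℕ} (hx : StasheffFamily x N)
    (hu : IsTubing N (insert u F)) (hu' : IsTubing N (insert u' F)) (hF : (0, N) ∈ F)
    (hcard : F.card + 1 = N) (huF : u ∉ F) (hne : u ≠ u') (hab : a < b) (hb : b < N)
    (hunsep : Unseparated F a b) (ha' : InTube u' a) (hb' : ¬ InTube u' b) :
    potential x (Visible (insert u' F)) N = potential x (Visible (insert u F)) N * x a b := by
  have hFt : IsTubing N F := ⟨hF, fun I hI => hu.bounds I (Finset.mem_insert_of_mem hI),
    fun I hI J hJ => hu.compat I (Finset.mem_insert_of_mem hI) J (Finset.mem_insert_of_mem hJ)⟩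
  obtain ⟨J, hJ, hJa, hmin⟩ := hFt.exists_min (hab.trans hb)
  have hw : IsWall N F a b J := ⟨hFt, hcard, hab, hb, hunsep, hJ, hJa, hmin⟩
  have hl := hw.eq_lower hu' ha' hb'
  have hsep : ¬ (InTube u a ↔ InTube u b) := by
    intro hiff
    refine hab.ne (hu.eq_of_unseparated (by rw [Finset.card_insert_of_notMem huF, hcard])
      (hab.trans hb) hb fun I hI => ?_)
    rcases Finset.mem_insert.1 hI with rfl | hI
    · exact hiff
    · exact hunsep I hI
  have hua : ¬ InTube u a := fun hua =>
    hne ((hw.eq_lower hu hua fun hub => hsep (iff_of_true hua hub)).trans hl.symm)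
  have hub : InTube u b := by
    by_contra hub
    exact hsep (iff_of_false hua hub)
  have hup := hw.eq_upper hu hua hub
  subst hl hup
  exact (hw.crossing hu' hu).potential_eq hx

/-! ### The homomorphism from the picture group to the Stasheff group. -/

section ToStasheff

/-- The tubes of a set of objects, together with the full interval. -/
noncomputable def tubes {m : ℕ} (T : Finset (ClusterIndec (LinearA m))) : Finset (ℕ × ℕ) :=
  insert (0, m + 1) (T.image tube)

variable {K : Type u} [Field K] {m : ℕ}

theorem card_tubes (T : Finset (ClusterIndec (LinearA m))) : (tubes T).card = T.card + 1 := by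
  rw [tubes, Finset.card_insert_of_notMem, Finset.card_image_of_injective _ (tube_injective m)]
  intro h
  obtain ⟨v, -, hv⟩ := Finset.mem_image.1 h
  have := isTube_tube v
  rw [hv] at this
  simp [IsTube] at this

theorem tubes_insert (v : ClusterIndec (LinearA m)) (T : Finset (ClusterIndec (LinearA m))) :
    tubes (insert v T) = insert (tube v) (tubes T) := by
  rw [tubes, tubes, Finset.image_insert, Finset.insert_comm]

theorem forall_mem_tubes {T : Finset (ClusterIndec (LinearA m))} {P : ℕ × ℕ → Prop} :
    (∀ I ∈ tubes T, P I) ↔ P (0, m + 1) ∧ ∀ v ∈ T, P (tube v) := by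
  rw [tubes, Finset.forall_mem_insert, Finset.forall_mem_image]

theorem tube_mem_tubes_iff {T : Finset (ClusterIndec (LinearA m))}
    {v : ClusterIndec (LinearA m)} : tube v ∈ tubes T ↔ v ∈ T := by
  have h : tube v ≠ (0, m + 1) := fun h => by
    have := isTube_tube v
    rw [h] at this
    simp [IsTube] at this
  simp [tubes, h, (tube_injective m).eq_iff]

theorem IsSimplex.isTubing {T : Finset (ClusterIndec (LinearA m))} (h : IsSimplex K T) :
    IsTubing (m + 1) (tubes T) := by
  refine ⟨Finset.mem_insert_self _ _, ?_, ?_⟩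
  · rw [forall_mem_tubes]
    exact ⟨by simp, fun v _ => ⟨(isTube_tube v).1, (isTube_tube v).2.1⟩⟩
  · simp only [forall_mem_tubes]
    refine ⟨⟨Or.inl ⟨le_rfl, le_rfl⟩, fun v _ => Or.inl ⟨Nat.zero_le _, (isTube_tube v).2.1⟩⟩,
      fun v hv => ⟨Or.inr (Or.inl ⟨Nat.zero_le _, (isTube_tube v).2.1⟩), fun w hw => ?_⟩⟩
    exact (extOrthogonal_iff K v w).1 (h v hv w hw)

theorem exists_insert_inter {α : Type*} [DecidableEq α] {T T' : Finset α}
    (h : (T ∩ T').card + 1 = T.card) : ∃ w ∈ T, w ∉ T' ∧ T = insert w (T ∩ T') := by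
  have h1 := Finset.card_sdiff_add_card_inter T T'
  obtain ⟨w, hw⟩ := Finset.card_eq_one.1 (show (T \ T').card = 1 by omega)
  have hwm : w ∈ T \ T' := by simp [hw]
  rw [Finset.mem_sdiff] at hwm
  refine ⟨w, hwm.1, hwm.2, ?_⟩
  conv_lhs => rw [← Finset.sdiff_union_inter T T', hw]
  rfl

/-- Lying in D(M_α) enters only through g · α = 0, which says that the shared tubes do not separate
a from b. -/
theorem DualEdge.potential_eq {G : Type*} [Group G] {x : ℕ → ℕ → G}
    (hx : StasheffFamily x (m + 1)) {T T' : Finset (ClusterIndec (LinearA m))}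
    {l : PosRoot (LinearA m) × Bool} (h : DualEdge K T T' l) :
    potential x (Visible (tubes T')) (m + 1) = potential x (Visible (tubes T)) (m + 1) *
      cond l.2 (x (tube (Sum.inl l.1)).1 (tube (Sum.inl l.1)).2)
        (x (tube (Sum.inl l.1)).1 (tube (Sum.inl l.1)).2)⁻¹ := by
  obtain ⟨hT, hT', hcard, ⟨M, hM, hdom⟩, hsign⟩ := h
  obtain ⟨α, ε⟩ := l
  have hab := tube_inl_fst_lt α
  have hb := tube_inl_snd_le α
  have hα := root_eq_indicator α
  dsimp only at hM hsign ⊢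
  rw [hα] at hM hsign
  generalize (tube (Sum.inl α)).1 = a at *
  generalize (tube (Sum.inl α)).2 = b at *
  obtain ⟨w, hwT, hwT', hw⟩ := exists_insert_inter (hcard.trans hT.2.symm)
  obtain ⟨w', hwT₁, hwT₁', hw'⟩ := exists_insert_inter (T := T') (T' := T)
    (by rw [Finset.inter_comm, hcard, hT'.2])
  rw [Finset.inter_comm] at hw'
  have hs := hsign w' (Finset.mem_sdiff.2 ⟨hwT₁, hwT₁'⟩)
  have hunsep : Unseparated (tubes (T ∩ T')) a b := by
    rw [Unseparated, forall_mem_tubes]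
    refine ⟨by simp only [InTube]; omega, fun v hv => ?_⟩
    have h1 := (hdom v hv).1
    simp only [(hM.2 _).2] at h1
    exact (sum_gVector_mul_indicator_eq_zero_iff hab hb v).1 h1
  have htub := hT.1.isTubing
  have htub' := hT'.1.isTubing
  rw [hw, tubes_insert] at htub
  rw [hw', tubes_insert] at htub'
  have hcF : (tubes (T ∩ T')).card + 1 = m + 1 := by
    rw [card_tubes, hcard, card_eq]
  have hne : tube w ≠ tube w' := fun h => hwT' (tube_injective m h ▸ hwT₁)
  have hwF : tube w ∉ tubes (T ∩ T') := by
    rw [tube_mem_tubes_iff, Finset.mem_inter]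
    exact fun h => hwT' h.2
  have hwF' : tube w' ∉ tubes (T ∩ T') := by
    rw [tube_mem_tubes_iff, Finset.mem_inter]
    exact fun h => hwT₁' h.1
  have hfull : (0, m + 1) ∈ tubes (T ∩ T') := Finset.mem_insert_self _ _
  conv_lhs => rw [hw', tubes_insert]
  conv_rhs => rw [hw, tubes_insert]
  cases ε
  -- A negative crossing is a positive one read backwards. The old tube must contain a and not b,
  -- since otherwise both tubes would be the same upper completion.
  · have hw'b := (sum_gVector_mul_indicator_neg_iff hab hb w').1 (by simpa using hs)
    have hsep : ¬ (InTube (tube w) a ↔ InTube (tube w) b) := by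
      intro hiff
      refine hab.ne (htub.eq_of_unseparated (by rw [Finset.card_insert_of_notMem hwF, hcF])
        (by omega) (by omega) fun I hI => ?_)
      rcases Finset.mem_insert.1 hI with rfl | hI
      · exact hiff
      · exact hunsep I hI
    have hwa : InTube (tube w) a ∧ ¬ InTube (tube w) b := by
      by_contra hcon
      have hFt : IsTubing (m + 1) (tubes (T ∩ T')) := IsSimplex.isTubing (K := K)
        fun u hu v hv => hT.1 u (Finset.mem_inter.1 hu).1 v (Finset.mem_inter.1 hv).1
      obtain ⟨J, hJ, hJa, hmin⟩ := hFt.exists_min (a := a) (by omega)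
      have hwall : IsWall (m + 1) (tubes (T ∩ T')) a b J :=
        ⟨hFt, hcF, hab, by omega, hunsep, hJ, hJa, hmin⟩
      exact hne ((hwall.eq_upper htub (by tauto) (by tauto)).trans
        (hwall.eq_upper htub' hw'b.1 hw'b.2).symm)
    rw [potential_insert hx htub' htub hfull hcF hwF' hne.symm hab (by omega) hunsep hwa.1 hwa.2]
    simp
  · have hw'a := (sum_gVector_mul_indicator_pos_iff hab hb w').1 (by simpa using hs)
    exact potential_insert hx htub htub' hfull hcF hwF hne hab (by omega) hunsep hw'a.1 hw'a.2

theorem IsDualPolygon.prod_eq_one {G : Type*} [Group G] {x : ℕ → ℕ → G}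
    (hx : StasheffFamily x (m + 1)) {ρ : Finset (ClusterIndec (LinearA m))} {k : ℕ}
    {T : ℕ → Finset (ClusterIndec (LinearA m))} {l : ℕ → PosRoot (LinearA m) × Bool}
    (h : IsDualPolygon K ρ k T l) :
    FreeGroup.lift (fun α => x (tube (Sum.inl α)).1 (tube (Sum.inl α)).2)
      (FreeGroup.mk ((List.range k).map l)) = 1 := by
  -- The potential at T i is the potential at T 0 times the word read so far; the polygon closes up
  -- at i = k.
  have key : ∀ i ≤ k, potential x (Visible (tubes (T i))) (m + 1) =
      potential x (Visible (tubes (T 0))) (m + 1) *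
        FreeGroup.lift (fun α => x (tube (Sum.inl α)).1 (tube (Sum.inl α)).2)
          (FreeGroup.mk ((List.range i).map l)) := by
    intro i
    induction i with
    | zero => simp
    | succ i ih =>
      intro hi
      rw [(h.edge i (by omega)).potential_eq hx, ih (by omega), List.range_succ, List.map_append,
        ← FreeGroup.mul_mk, map_mul, mul_assoc]
      simp [FreeGroup.lift_mk]
  have h1 := key k le_rfl
  rw [h.closed] at h1
  simpa using h1.symm

/-- The generators of the Stasheff group, extended to all pairs of natural numbers. -/
def stasheffGenerator (n i j : ℕ) : StasheffGroup n :=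
  if h : i < j ∧ j < n then
    PresentedGroup.of ⟨(⟨i, h.1.trans h.2⟩, ⟨j, h.2⟩), Fin.mk_lt_mk.2 h.1⟩
  else 1

theorem stasheffGenerator_val {n : ℕ} (p : StasheffGen n) :
    stasheffGenerator n p.1.1 p.1.2 = PresentedGroup.of p := by
  have h : (p.1.1 : ℕ) < p.1.2 ∧ (p.1.2 : ℕ) < n := ⟨p.2, p.1.2.2⟩
  rw [stasheffGenerator, dif_pos h]

theorem map_stasheffComm {G H : Type*} [Group G] [Group H] (f : G →* H) (a b : G) :
    f (stasheffComm a b) = stasheffComm (f a) (f b) := by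
  simp [stasheffComm]

theorem stasheffComm_eq_one_iff {G : Type*} [Group G] {a b : G} :
    stasheffComm a b = 1 ↔ Commute a b := by
  rw [stasheffComm, mul_inv_eq_one, mul_assoc, inv_mul_eq_iff_eq_mul, Commute, SemiconjBy]

theorem stasheffComm_mul_inv_eq_one_iff {G : Type*} [Group G] {a b c : G} :
    stasheffComm a b * c⁻¹ = 1 ↔ a * b = b * c * a := by
  rw [mul_inv_eq_one, stasheffComm, mul_inv_eq_iff_eq_mul, mul_assoc, inv_mul_eq_iff_eq_mul,
    mul_assoc]

theorem stasheffFamily_stasheffGenerator (n : ℕ) : StasheffFamily (stasheffGenerator n) n := by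
  have hcomm : ∀ (i j k l : Fin n) (hij : i < j) (hkl : k < l)
      (_ : i ≠ k ∧ i ≠ l ∧ j ≠ k ∧ j ≠ l)
      (_ : Disjoint (openInterval i j) (openInterval k l) ∨
        openInterval i j ⊆ openInterval k l ∨ openInterval k l ⊆ openInterval i j),
      Commute (stasheffGenerator n i j) (stasheffGenerator n k l) := by
    intro i j k l hij hkl h1 h2
    have h := PresentedGroup.one_of_mem (rels := {r | StasheffRel n r})
      (StasheffRel.commute i j k l hij hkl h1 h2)
    rw [map_stasheffComm, stasheffComm_eq_one_iff] at h
    rw [stasheffGenerator_val ⟨(i, j), hij⟩, stasheffGenerator_val ⟨(k, l), hkl⟩]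
    exact h
  refine ⟨?_, ?_, ?_⟩
  · intro i j k hij hjk hk
    have h := PresentedGroup.one_of_mem (rels := {r | StasheffRel n r})
      (StasheffRel.comm ⟨i, by omega⟩ ⟨j, by omega⟩ ⟨k, hk⟩ hij hjk)
    rw [map_mul, map_inv, map_stasheffComm, stasheffComm_mul_inv_eq_one_iff] at h
    simp only [stasheffGenerator, hij, hjk, hk, hij.trans hjk, hjk.trans hk, and_self, dif_pos]
    exact h
  · intro i j k l hij hjk hkl hl
    refine hcomm ⟨i, by omega⟩ ⟨j, by omega⟩ ⟨k, by omega⟩ ⟨l, hl⟩ hij hkl ?_ (Or.inl ?_)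
    · simp only [ne_eq, Fin.mk.injEq]
      omega
    · refine Set.disjoint_left.2 fun y hy hy' => ?_
      have h1 : y < j := hy.2
      have h2 : (k : ℝ) < y := hy'.1
      have h3 : (j : ℝ) < k := by exact_mod_cast hjk
      linarith
  · intro i j k l hij hjk hkl hl
    refine hcomm ⟨j, by omega⟩ ⟨k, by omega⟩ ⟨i, by omega⟩ ⟨l, hl⟩ hjk (by
      simp only [Fin.mk_lt_mk]; omega) ?_ (Or.inr (Or.inl ?_))
    · simp only [ne_eq, Fin.mk.injEq]
      omega
    · exact Set.Ioo_subset_Ioo (by simpa using hij.le) (by simpa using hkl.le)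

variable (K m)

/-- The homomorphism from the picture group to the Stasheff group. -/
noncomputable def pictureToStasheff :
    PictureGroup K (LinearA m) →* StasheffGroup (m + 1) :=
  PresentedGroup.toGroup
    (f := fun α => stasheffGenerator (m + 1) (tube (Sum.inl α)).1 (tube (Sum.inl α)).2) (by
      rintro _ ⟨ρ, k, T, l, h, rfl⟩
      exact h.prod_eq_one (stasheffFamily_stasheffGenerator (m + 1)))

theorem pictureToStasheff_of (p : StasheffGen (m + 1)) :
    pictureToStasheff K m (PresentedGroup.of (rootEquiv m p)) = PresentedGroup.of p := by
  rw [pictureToStasheff, PresentedGroup.toGroup.of, tube_rootEquiv]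
  exact stasheffGenerator_val p

end ToStasheff

/-! ### From polygons of tubes to relators of the picture group. -/

section Polygon

variable (K : Type u) [Field K] {m d : ℕ}

/-- The `i`-th edge of the cycle of length `d + 1`. -/
def cycleEdge (d i : ℕ) : Finset (Fin (d + 1)) :=
  {Fin.ofNat (d + 1) i, Fin.ofNat (d + 1) (i + 1)}

/-- Two elements of the cycle are equal or neighbours. -/
abbrev CycleAdj (i j : Fin (d + 1)) : Prop := j = i ∨ j = i + 1 ∨ i = j + 1

theorem cycleEdge_injOn (hd : d = 3 ∨ d = 4) :
    ∀ i < d + 1, ∀ j < d + 1, cycleEdge d i = cycleEdge d j → i = j := by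
  rcases hd with rfl | rfl <;> decide

theorem card_cycleEdge (hd : d = 3 ∨ d = 4) : ∀ i < d + 2, (cycleEdge d i).card = 2 := by
  rcases hd with rfl | rfl <;> decide

theorem cycleAdj_of_mem_cycleEdge (hd : d = 3 ∨ d = 4) :
    ∀ i < d + 2, ∀ x ∈ cycleEdge d i, ∀ y ∈ cycleEdge d i, CycleAdj x y := by
  rcases hd with rfl | rfl <;> decide

theorem exists_cycleEdge_eq (hd : d = 3 ∨ d = 4) :
    ∀ x y : Fin (d + 1), x ≠ y → CycleAdj x y → ∃ i < d + 1, cycleEdge d i = {x, y} := by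
  rcases hd with rfl | rfl <;> decide

theorem cycleEdge_inter (hd : d = 3 ∨ d = 4) :
    ∀ i < d + 1, cycleEdge d i ∩ cycleEdge d (i + 1) = {Fin.ofNat (d + 1) (i + 1)} := by
  rcases hd with rfl | rfl <;> decide

theorem cycleEdge_sdiff (hd : d = 3 ∨ d = 4) :
    ∀ i < d + 1, cycleEdge d (i + 1) \ cycleEdge d i = {Fin.ofNat (d + 1) (i + 2)} := by
  rcases hd with rfl | rfl <;> decide

theorem ofNat_add (hd : d = 3 ∨ d = 4) : ∀ i < d + 1,
    Fin.ofNat (d + 1) (i + 1) = Fin.ofNat (d + 1) i + 1 ∧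
      Fin.ofNat (d + 1) (i + 2) = Fin.ofNat (d + 1) i + 2 := by
  rcases hd with rfl | rfl <;> decide

theorem cycleEdge_self (hd : d = 3 ∨ d = 4) : cycleEdge d (d + 1) = cycleEdge d 0 := by
  rcases hd with rfl | rfl <;> decide

/-- The combinatorial data of a polygon of tubings: a family `R`, the tubes `I i` that complete it
cyclically, and the walls between successive completions. -/
structure TubePolygon (m d : ℕ) (R : Finset (ℕ × ℕ)) (I : Fin (d + 1) → ℕ × ℕ)
    (l : Fin (d + 1) → StasheffGen (m + 1) × Bool) : Prop where
  isTube : ∀ J ∈ R, IsTube m J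
  compat : ∀ J ∈ R, ∀ L ∈ R, Compat J L
  card : R.card + 2 = m
  isTube' : ∀ i, IsTube m (I i)
  inj : Function.Injective I
  notMem : ∀ i, I i ∉ R
  compat' : ∀ i, ∀ J ∈ R, Compat (I i) J
  maximal : ∀ J, IsTube m J → J ∉ R → (∀ L ∈ R, Compat J L) → ∃ i, I i = J
  adj : ∀ i j, Compat (I i) (I j) ↔ CycleAdj i j
  wall : ∀ i, ∀ J ∈ R, InTube J (l i).1.1.1 ↔ InTube J (l i).1.1.2
  wall' : ∀ i, InTube (I (i + 1)) (l i).1.1.1 ↔ InTube (I (i + 1)) (l i).1.1.2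
  sign : ∀ i, if (l i).2 then InTube (I (i + 2)) (l i).1.1.1 ∧ ¬ InTube (I (i + 2)) (l i).1.1.2
    else ¬ InTube (I (i + 2)) (l i).1.1.1 ∧ InTube (I (i + 2)) (l i).1.1.2

/-- The i-th vertex of the polygon is R together with I i and I (i + 1). Edge i therefore keeps I (i
+ 1) and gains I (i + 2), which explains the shifts in `wall'` and `sign`. Maximality and adjacency
show that no other cluster contains R. -/
theorem TubePolygon.mem_pictureRels {R : Finset (ℕ × ℕ)} {I : Fin (d + 1) → ℕ × ℕ}
    {l : Fin (d + 1) → StasheffGen (m + 1) × Bool} (h : TubePolygon m d R I l)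
    (hd : d = 3 ∨ d = 4) : FreeGroup.mk ((List.range (d + 1)).map fun i =>
      (rootEquiv m (l (Fin.ofNat (d + 1) i)).1, (l (Fin.ofNat (d + 1) i)).2)) ∈
        pictureRels K (LinearA m) := by
  classical
  choose u hu using fun i => exists_tube_eq (h.isTube' i)
  have huinj : Function.Injective u := fun i j hij => h.inj (by rw [← hu, ← hu, hij])
  set ρ : Finset (ClusterIndec (LinearA m)) := R.preimage tube (tube_injective m).injOn with hρ
  have hmem : ∀ {v}, v ∈ ρ ↔ tube v ∈ R := Finset.mem_preimage
  have hρcard : ρ.card = R.card := by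
    rw [← Finset.card_image_of_injective ρ (tube_injective m)]
    congr 1
    ext J
    simp only [Finset.mem_image, hmem]
    constructor
    · rintro ⟨v, hv, rfl⟩
      exact hv
    · intro hJ
      obtain ⟨v, rfl⟩ := exists_tube_eq (h.isTube J hJ)
      exact ⟨v, hJ, rfl⟩
  have huρ : ∀ i, u i ∉ ρ := fun i => by rw [hmem, hu]; exact h.notMem i
  have hdisj : ∀ E : Finset (Fin (d + 1)), Disjoint ρ (E.image u) := by
    intro E
    rw [Finset.disjoint_right]
    intro v hv
    obtain ⟨i, -, rfl⟩ := Finset.mem_image.1 hv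
    exact huρ i
  let T : ℕ → Finset (ClusterIndec (LinearA m)) := fun i => ρ ∪ (cycleEdge d i).image u
  have hTinj : ∀ i j, T i = T j → cycleEdge d i = cycleEdge d j := by
    intro i j hij
    apply Finset.image_injective huinj
    have h1 := congrArg (· \ ρ) hij
    simp only [T, Finset.union_sdiff_left] at h1
    rwa [Finset.sdiff_eq_self_of_disjoint (hdisj _).symm,
      Finset.sdiff_eq_self_of_disjoint (hdisj _).symm] at h1
  have hcluster : ∀ i < d + 2, IsCluster K (T i) := by
    intro i hi
    constructor
    · intro v hv w hw
      rw [extOrthogonal_iff]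
      simp only [T, Finset.mem_union, Finset.mem_image, hmem] at hv hw
      rcases hv with hv | ⟨x, hx, rfl⟩ <;> rcases hw with hw | ⟨y, hy, rfl⟩
      · exact h.compat _ hv _ hw
      · have := h.compat' y _ hv
        rw [← hu] at this
        unfold Compat at this ⊢
        omega
      · rw [hu]
        exact h.compat' x _ hw
      · rw [hu, hu, h.adj]
        exact cycleAdj_of_mem_cycleEdge hd i hi x hx y hy
    · rw [Finset.card_union_of_disjoint (hdisj _), Finset.card_image_of_injective _ huinj,
        card_cycleEdge hd i hi, hρcard, h.card, card_eq]
  refine ⟨ρ, d + 1, T, _, ⟨?_, ?_, by omega, ?_, ?_, ?_, ?_⟩, rfl⟩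
  · intro v hv w hw
    rw [extOrthogonal_iff]
    exact h.compat _ (hmem.1 hv) _ (hmem.1 hw)
  · rw [hρcard, h.card, card_eq]
  · simp only [T, cycleEdge_self hd]
  · intro i hi j hj hij
    exact cycleEdge_injOn hd i hi j hj (hTinj i j hij)
  · intro C
    constructor
    · rintro ⟨hC, hρC⟩
      have hc : (C \ ρ).card = 2 := by
        rw [Finset.card_sdiff_of_subset hρC, hC.2, hρcard, card_eq, ← h.card]
        omega
      obtain ⟨v, w, hvw, hCeq⟩ := Finset.card_eq_two.1 hc
      have hmax : ∀ v ∈ C \ ρ, ∃ i, u i = v := by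
        intro v hv
        rw [Finset.mem_sdiff, hmem] at hv
        obtain ⟨i, hi⟩ := h.maximal (tube v) (isTube_tube v) hv.2 fun L hL => by
          obtain ⟨w, rfl⟩ := exists_tube_eq (h.isTube L hL)
          exact (extOrthogonal_iff K v w).1 (hC.1 v hv.1 w (hρC (hmem.2 hL)))
        exact ⟨i, tube_injective m ((hu i).trans hi)⟩
      have hv : v ∈ C \ ρ := by simp [hCeq]
      have hw : w ∈ C \ ρ := by simp [hCeq]
      obtain ⟨x, rfl⟩ := hmax v hv
      obtain ⟨y, rfl⟩ := hmax w hw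
      have hxy : CycleAdj x y := by
        rw [← h.adj, ← hu, ← hu, ← extOrthogonal_iff K]
        exact hC.1 _ (Finset.mem_sdiff.1 hv).1 _ (Finset.mem_sdiff.1 hw).1
      obtain ⟨i, hi, hE⟩ := exists_cycleEdge_eq hd x y (fun h => hvw (by rw [h])) hxy
      refine ⟨i, hi, ?_⟩
      simp only [T, hE, Finset.image_insert, Finset.image_singleton]
      rw [← hCeq, Finset.union_sdiff_of_subset hρC]
    · rintro ⟨i, hi, rfl⟩
      exact ⟨hcluster i (by omega), Finset.subset_union_left⟩
  · intro i hi
    have hinter : T i ∩ T (i + 1) = insert (u (Fin.ofNat (d + 1) (i + 1))) ρ := by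
      simp only [T]
      rw [← Finset.union_inter_distrib_left, ← Finset.image_inter _ _ huinj,
        cycleEdge_inter hd i hi, Finset.image_singleton, Finset.union_comm]
      rfl
    have hsdiff : T (i + 1) \ T i = {u (Fin.ofNat (d + 1) (i + 2))} := by
      simp only [T]
      rw [← Finset.image_singleton, ← cycleEdge_sdiff hd i hi, Finset.image_sdiff _ _ huinj]
      ext v
      have h0 : v ∈ ρ → v ∉ (cycleEdge d (i + 1)).image u := fun h =>
        Finset.disjoint_left.1 (hdisj _) h
      simp only [Finset.mem_sdiff, Finset.mem_union]
      tauto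
    obtain ⟨h1, h2⟩ := ofNat_add hd i hi
    set c := Fin.ofNat (d + 1) i
    have hab : ((l c).1.1.1 : ℕ) < (l c).1.1.2 := (l c).1.2
    have hb : ((l c).1.1.2 : ℕ) ≤ m := Nat.lt_succ_iff.1 (l c).1.1.2.2
    have hroot : (rootEquiv m (l c).1).1 = indicator m (l c).1.1.1 (l c).1.1.2 := rfl
    refine ⟨hcluster i (by omega), hcluster (i + 1) (by omega), ?_, ?_, ?_⟩
    · rw [hinter, Finset.card_insert_of_notMem (huρ _), hρcard, card_eq, ← h.card]
    · refine ⟨QuiverRep.intervalRep K m (l c).1.1.1 (l c).1.1.2,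
        QuiverRep.intervalRep_isIndecWithDim hab hb, fun v hv => ?_⟩
      apply QuiverRep.gVector_mem_domain hab hb
      rw [hinter, Finset.mem_insert] at hv
      rcases hv with rfl | hv
      · rw [hu, h1]
        exact h.wall' c
      · exact h.wall c _ (hmem.1 hv)
    · intro v hv
      rw [hsdiff, Finset.mem_singleton] at hv
      subst hv
      have hs := h.sign c
      simp only [hroot]
      rw [sum_gVector_mul_indicator_pos_iff hab hb, sum_gVector_mul_indicator_neg_iff hab hb, hu,
        h2]
      exact hs

end Polygon

/-! ### Isolating the points outside a set S. -/

section Gaps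

/-- The first element of `S` after `c`, or `m + 1` if there is none. -/
noncomputable def nextIn (m : ℕ) (S : Finset ℕ) (c : ℕ) : ℕ :=
  sInf {x | c < x ∧ (x ∈ S ∨ x = m + 1)}

variable {m : ℕ} {S : Finset ℕ}

theorem nextIn_mem {c : ℕ} (hc : c ≤ m) :
    c < nextIn m S c ∧ (nextIn m S c ∈ S ∨ nextIn m S c = m + 1) :=
  Nat.sInf_mem (s := {x | c < x ∧ (x ∈ S ∨ x = m + 1)})
    ⟨m + 1, Nat.lt_succ_of_le hc, Or.inr rfl⟩

theorem nextIn_le_of_mem {c s : ℕ} (hs : s ∈ S) (hcs : c < s) : nextIn m S c ≤ s :=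
  Nat.sInf_le ⟨hcs, Or.inl hs⟩

theorem nextIn_le {c : ℕ} (hc : c ≤ m) : nextIn m S c ≤ m + 1 :=
  Nat.sInf_le ⟨Nat.lt_succ_of_le hc, Or.inr rfl⟩

/-- The intervals from the points outside `S` to the end of the surrounding gap of `S`. -/
noncomputable def gapTubes (m : ℕ) (S : Finset ℕ) : Finset (ℕ × ℕ) :=
  (Finset.range (m + 1) \ S).image fun c => (c, nextIn m S c)

theorem mem_gapTubes {J : ℕ × ℕ} :
    J ∈ gapTubes m S ↔ J.1 ≤ m ∧ J.1 ∉ S ∧ J.2 = nextIn m S J.1 := by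
  obtain ⟨s, e⟩ := J
  simp only [gapTubes, Finset.mem_image, Finset.mem_sdiff, Finset.mem_range, Prod.mk.injEq,
    Nat.lt_succ_iff]
  constructor
  · rintro ⟨c, ⟨h1, h2⟩, rfl, rfl⟩
    exact ⟨h1, h2, rfl⟩
  · rintro ⟨h1, h2, h3⟩
    exact ⟨s, ⟨h1, h2⟩, rfl, h3.symm⟩

theorem card_gapTubes (hS : S ⊆ Finset.range (m + 1)) :
    (gapTubes m S).card + S.card = m + 1 := by
  rw [gapTubes, Finset.card_image_of_injective _ fun _ _ h => (Prod.ext_iff.1 h).1,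
    Finset.card_sdiff_add_card_eq_card hS, Finset.card_range]

theorem notMem_of_inTube_gapTubes {J : ℕ × ℕ} (hJ : J ∈ gapTubes m S) {s : ℕ} (hs : s ∈ S) :
    ¬ InTube J s := by
  rw [mem_gapTubes] at hJ
  rintro ⟨h1, h2⟩
  have : J.1 ≠ s := fun h => hJ.2.1 (h ▸ hs)
  have := nextIn_le_of_mem (m := m) (c := J.1) hs (by omega)
  omega

theorem isTube_of_mem_gapTubes (hS0 : S.Nonempty) (hS : S ⊆ Finset.range (m + 1)) {J : ℕ × ℕ}
    (hJ : J ∈ gapTubes m S) : IsTube m J := by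
  have h := hJ
  rw [mem_gapTubes] at h
  have h1 := nextIn_mem (S := S) h.1
  have h2 := nextIn_le (S := S) h.1
  refine ⟨by omega, by omega, ?_⟩
  by_contra hcon
  obtain ⟨s, hs⟩ := hS0
  have h3 := notMem_of_inTube_gapTubes hJ hs
  have h4 := Finset.mem_range.1 (hS hs)
  unfold InTube at h3
  omega

theorem compat_of_mem_gapTubes {J L : ℕ × ℕ} (hJ : J ∈ gapTubes m S) (hL : L ∈ gapTubes m S) :
    Compat J L := by
  have key : ∀ {J L : ℕ × ℕ}, J ∈ gapTubes m S → L ∈ gapTubes m S → J.1 ≤ L.1 →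
      (J.1 ≤ L.1 ∧ L.2 ≤ J.2) ∨ J.2 < L.1 := by
    intro J L hJ hL hle
    rw [mem_gapTubes] at hJ hL
    have h1 := nextIn_mem (S := S) hJ.1
    have h2 := nextIn_le (S := S) hL.1
    by_cases hlt : L.1 < nextIn m S J.1
    · left
      rcases h1.2 with h3 | h3
      · have := nextIn_le_of_mem (m := m) h3 hlt
        omega
      · omega
    · right
      have h3 : L.1 ≠ nextIn m S J.1 := by
        intro h
        rcases h1.2 with h3 | h3
        · exact hL.2.1 (h ▸ h3)
        · omega
      omega
  unfold Compat
  rcases le_total J.1 L.1 with h | h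
  · have := key hJ hL h
    omega
  · have := key hL hJ h
    omega

/-- The interval starts and ends next to elements of `S` and contains an element of `S`. -/
def SpansGaps (m : ℕ) (S : Finset ℕ) (J : ℕ × ℕ) : Prop :=
  (J.1 = 0 ∨ ∃ s ∈ S, J.1 = s + 1) ∧ (J.2 = m + 1 ∨ J.2 ∈ S) ∧ ∃ s ∈ S, InTube J s

theorem SpansGaps.notMem {J : ℕ × ℕ} (h : SpansGaps m S J) : J ∉ gapTubes m S := by
  obtain ⟨-, -, s, hs, hJ⟩ := h
  exact fun hJ' => notMem_of_inTube_gapTubes hJ' hs hJ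

theorem SpansGaps.compat {J L : ℕ × ℕ} (h : SpansGaps m S J) (hL : L ∈ gapTubes m S) :
    Compat J L := by
  obtain ⟨h1, h2, -⟩ := h
  rw [mem_gapTubes] at hL
  obtain ⟨hLm, hLS, hL2⟩ := hL
  have h3 := nextIn_le (S := S) hLm
  unfold Compat
  by_cases hlt : L.1 < J.1
  · rcases h1 with h1 | ⟨s, hs, h1⟩
    · omega
    · have : L.1 ≠ s := fun h => hLS (h ▸ hs)
      have := nextIn_le_of_mem (m := m) hs (c := L.1) (by omega)
      omega
  · rcases h2 with h2 | h2
    · omega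
    · have : L.1 ≠ J.2 := fun h => hLS (h ▸ h2)
      by_cases hlt' : L.1 < J.2
      · have := nextIn_le_of_mem (m := m) h2 hlt'
        omega
      · omega

/-- If J.2 or J.1 − 1 were a point outside S, the gap tube starting there would touch or cross J. If
J met no point of S, it would itself be a gap tube. -/
theorem spansGaps_of_compat {J : ℕ × ℕ} (hJ : IsTube m J) (hJS : J ∉ gapTubes m S)
    (hc : ∀ L ∈ gapTubes m S, Compat J L) : SpansGaps m S J := by
  obtain ⟨hJ1, hJ2, -⟩ := hJ
  have hc' : ∀ c ≤ m, c ∉ S → Compat J (c, nextIn m S c) := fun c hc1 hc2 =>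
    hc _ (mem_gapTubes.2 ⟨hc1, hc2, rfl⟩)
  have hend : J.2 = m + 1 ∨ J.2 ∈ S := by
    by_contra! hcon
    have h1 := hc' J.2 (by omega) hcon.2
    have h2 := nextIn_mem (S := S) (c := J.2) (m := m) (by omega)
    simp only [Compat] at h1
    omega
  have hmeet : ∃ s ∈ S, InTube J s := by
    by_contra! hcon
    have h1 : J.1 ∉ S := fun h => hcon _ h ⟨le_rfl, hJ1⟩
    have h2 := nextIn_mem (S := S) (c := J.1) (m := m) (by omega)
    have h3 := nextIn_le (S := S) (c := J.1) (m := m) (by omega)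
    refine hJS (mem_gapTubes.2 ⟨by omega, h1, le_antisymm ?_ ?_⟩)
    · rcases h2.2 with h4 | h4
      · have := hcon _ h4
        simp only [InTube] at this
        omega
      · omega
    · rcases hend with h4 | h4
      · omega
      · exact nextIn_le_of_mem h4 hJ1
  refine ⟨?_, hend, hmeet⟩
  by_contra! hcon
  have h1 : J.1 - 1 ∉ S := fun h => hcon.2 _ h (by omega)
  have h2 := hc' (J.1 - 1) (by omega) h1
  have h3 := nextIn_mem (S := S) (c := J.1 - 1) (m := m) (by omega)
  obtain ⟨s, hs, hsJ⟩ := hmeet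
  have h4 := nextIn_le_of_mem (m := m) (c := J.1 - 1) hs (by have := hsJ.1; omega)
  simp only [Compat, InTube] at h2 hsJ
  omega

end Gaps

/-! ### The pentagon and the two kinds of squares. -/

section Relations

variable {m d : ℕ}

/-- The m + 1 − |S| gap tubes and the tubes in X number m − 2, as codimension two requires. Gap
tubes avoid S and are compatible with every tube spanning gaps, so only conditions among spanning
tubes remain. -/
theorem tubePolygon_of_spansGaps {S : Finset ℕ} {X : Finset (ℕ × ℕ)} {I : Fin (d + 1) → ℕ × ℕ}
    {l : Fin (d + 1) → StasheffGen (m + 1) × Bool} (hS : S ⊆ Finset.range (m + 1))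
    (hcard : S.card = X.card + 3) (hX : ∀ J ∈ X, IsTube m J ∧ SpansGaps m S J)
    (hXX : ∀ J ∈ X, ∀ L ∈ X, Compat J L) (hI : ∀ i, IsTube m (I i) ∧ SpansGaps m S (I i))
    (hinj : Function.Injective I) (hIX : ∀ i, I i ∉ X ∧ ∀ J ∈ X, Compat (I i) J)
    (hmax : ∀ J, IsTube m J → SpansGaps m S J → J ∉ X → (∀ L ∈ X, Compat J L) → ∃ i, I i = J)
    (hadj : ∀ i j, Compat (I i) (I j) ↔ CycleAdj i j)
    (hl : ∀ i, ((l i).1.1.1 : ℕ) ∈ S ∧ ((l i).1.1.2 : ℕ) ∈ S)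
    (hlX : ∀ i, ∀ J ∈ X, InTube J (l i).1.1.1 ↔ InTube J (l i).1.1.2)
    (hlI : ∀ i, InTube (I (i + 1)) (l i).1.1.1 ↔ InTube (I (i + 1)) (l i).1.1.2)
    (hsign : ∀ i, if (l i).2 then
      InTube (I (i + 2)) (l i).1.1.1 ∧ ¬ InTube (I (i + 2)) (l i).1.1.2
      else ¬ InTube (I (i + 2)) (l i).1.1.1 ∧ InTube (I (i + 2)) (l i).1.1.2) :
    TubePolygon m d (gapTubes m S ∪ X) I l := by
  have hS0 : S.Nonempty := Finset.card_pos.1 (by omega)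
  have hSm := card_gapTubes hS
  refine ⟨?_, ?_, ?_, fun i => (hI i).1, hinj, ?_, ?_, ?_, hadj, ?_, hlI, hsign⟩
  · intro J hJ
    rcases Finset.mem_union.1 hJ with hJ | hJ
    · exact isTube_of_mem_gapTubes hS0 hS hJ
    · exact (hX J hJ).1
  · intro J hJ L hL
    rcases Finset.mem_union.1 hJ with hJ | hJ <;> rcases Finset.mem_union.1 hL with hL | hL
    · exact compat_of_mem_gapTubes hJ hL
    · have := (hX L hL).2.compat hJ
      unfold Compat at this ⊢
      omega
    · exact (hX J hJ).2.compat hL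
    · exact hXX J hJ L hL
  · rw [Finset.card_union_of_disjoint
      (Finset.disjoint_right.2 fun J hJ => (hX J hJ).2.notMem)]
    omega
  · intro i hi
    rcases Finset.mem_union.1 hi with hi | hi
    · exact (hI i).2.notMem hi
    · exact (hIX i).1 hi
  · intro i J hJ
    rcases Finset.mem_union.1 hJ with hJ | hJ
    · exact (hI i).2.compat hJ
    · exact (hIX i).2 J hJ
  · intro J hJ hJR hc
    rw [Finset.mem_union, not_or] at hJR
    exact hmax J hJ
      (spansGaps_of_compat hJ hJR.1 fun L hL => hc L (Finset.mem_union_left _ hL)) hJR.2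
      fun L hL => hc L (Finset.mem_union_right _ hL)
  · intro i J hJ
    rcases Finset.mem_union.1 hJ with hJ | hJ
    · exact iff_of_false (notMem_of_inTube_gapTubes hJ (hl i).1)
        (notMem_of_inTube_gapTubes hJ (hl i).2)
    · exact hlX i J hJ

/-- The generator `x_{ij}` of the Stasheff group as an index. -/
abbrev stasheffIndex (i j : ℕ) (hij : i < j) (hj : j ≤ m) : StasheffGen (m + 1) :=
  ⟨(⟨i, by omega⟩, ⟨j, by omega⟩), Fin.mk_lt_mk.2 hij⟩

/-- The five tubes meet {i, j, k} in {i}, {i, j}, {j}, {j, k}, {k}: all proper tubes of a path with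
three points. -/
theorem tubePolygon_pentagon {i j k : ℕ} (hij : i < j) (hjk : j < k) (hk : k ≤ m) :
    TubePolygon m 4 (gapTubes m {i, j, k} ∪ ∅)
      ![(0, j), (0, k), (i + 1, k), (i + 1, m + 1), (j + 1, m + 1)]
      ![(stasheffIndex i j hij (by omega), false), (stasheffIndex i k (by omega) hk, false),
        (stasheffIndex j k hjk hk, false), (stasheffIndex i j hij (by omega), true),
        (stasheffIndex j k hjk hk, true)] := by
  apply tubePolygon_of_spansGaps
  · intro s
    simp only [Finset.mem_insert, Finset.mem_singleton, Finset.mem_range]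
    omega
  · rw [Finset.card_eq_three.2 ⟨i, j, k, by omega, by omega, by omega, rfl⟩]
    rfl
  · simp
  · simp
  · intro c
    fin_cases c <;> simp [IsTube, SpansGaps] <;> omega
  · intro c c'
    fin_cases c <;> fin_cases c' <;> simp <;> omega
  · simp
  · rintro ⟨s, e⟩ h1 h2 - -
    simp only [IsTube, SpansGaps, InTube, Finset.mem_insert, Finset.mem_singleton,
      exists_eq_or_imp, exists_eq_left] at h1 h2
    have h3 : (s = 0 ∧ e = j) ∨ (s = 0 ∧ e = k) ∨ (s = i + 1 ∧ e = k) ∨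
        (s = i + 1 ∧ e = m + 1) ∨ (s = j + 1 ∧ e = m + 1) := by omega
    rcases h3 with ⟨rfl, rfl⟩ | ⟨rfl, rfl⟩ | ⟨rfl, rfl⟩ | ⟨rfl, rfl⟩ | ⟨rfl, rfl⟩
    exacts [⟨0, rfl⟩, ⟨1, rfl⟩, ⟨2, rfl⟩, ⟨3, rfl⟩, ⟨4, rfl⟩]
  · intro c c'
    fin_cases c <;> fin_cases c' <;> simp [Compat, CycleAdj] <;> omega
  · intro c
    fin_cases c <;> simp
  · simp
  · intro c
    fin_cases c <;> simp [InTube] <;> omega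
  · intro c
    fin_cases c <;> simp [InTube] <;> omega

/-- The extra tube meets S in {i, j}. The choice between {i} and {j} inside it is independent of the
choice between {i, j, k} and {l}, so the face is a square. -/
theorem tubePolygon_disjoint {i j k l : ℕ} (hij : i < j) (hjk : j < k) (hkl : k < l) (hl : l ≤ m) :
    TubePolygon m 3 (gapTubes m {i, j, k, l} ∪ {(0, k)})
      ![(0, j), (0, l), (i + 1, k), (k + 1, m + 1)]
      ![(stasheffIndex i j hij (by omega), false), (stasheffIndex k l hkl hl, false),
        (stasheffIndex i j hij (by omega), true), (stasheffIndex k l hkl hl, true)] := by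
  apply tubePolygon_of_spansGaps
  · intro s
    simp only [Finset.mem_insert, Finset.mem_singleton, Finset.mem_range]
    omega
  · rw [Finset.card_insert_of_notMem (by simp; omega),
      Finset.card_eq_three.2 ⟨j, k, l, by omega, by omega, by omega, rfl⟩]
    rfl
  · simp [IsTube, SpansGaps]
    omega
  · simp [Compat]
  · intro c
    fin_cases c <;> simp [IsTube, SpansGaps] <;> omega
  · intro c c'
    fin_cases c <;> fin_cases c' <;> simp <;> omega
  · intro c
    fin_cases c <;> simp [Compat] <;> omega
  · rintro ⟨s, e⟩ h1 h2 h3 h4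
    simp only [IsTube, SpansGaps, InTube, Finset.mem_insert, Finset.mem_singleton, Prod.mk.injEq,
      exists_eq_or_imp, exists_eq_left, forall_eq, Compat] at h1 h2 h3 h4
    have h5 : (s = 0 ∧ e = j) ∨ (s = 0 ∧ e = l) ∨ (s = i + 1 ∧ e = k) ∨
        (s = k + 1 ∧ e = m + 1) := by omega
    rcases h5 with ⟨rfl, rfl⟩ | ⟨rfl, rfl⟩ | ⟨rfl, rfl⟩ | ⟨rfl, rfl⟩
    exacts [⟨0, rfl⟩, ⟨1, rfl⟩, ⟨2, rfl⟩, ⟨3, rfl⟩]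
  · intro c c'
    fin_cases c <;> fin_cases c' <;> simp [Compat, CycleAdj] <;> omega
  · intro c
    fin_cases c <;> simp
  · intro c
    fin_cases c <;> simp [InTube] <;> omega
  · intro c
    fin_cases c <;> simp [InTube] <;> omega
  · intro c
    fin_cases c <;> simp [InTube] <;> omega

/-- Here the extra tube meets S in {j, k}; the independent choices are {j} or {k} inside it, and {i,
j, k} or {j, k, l} around it. -/
theorem tubePolygon_nested {i j k l : ℕ} (hij : i < j) (hjk : j < k) (hkl : k < l) (hl : l ≤ m) :
    TubePolygon m 3 (gapTubes m {i, j, k, l} ∪ {(i + 1, l)})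
      ![(i + 1, k), (0, l), (j + 1, l), (i + 1, m + 1)]
      ![(stasheffIndex j k hjk (by omega), false), (stasheffIndex i l (by omega) hl, false),
        (stasheffIndex j k hjk (by omega), true), (stasheffIndex i l (by omega) hl, true)] := by
  apply tubePolygon_of_spansGaps
  · intro s
    simp only [Finset.mem_insert, Finset.mem_singleton, Finset.mem_range]
    omega
  · rw [Finset.card_insert_of_notMem (by simp; omega),
      Finset.card_eq_three.2 ⟨j, k, l, by omega, by omega, by omega, rfl⟩]
    rfl
  · simp [IsTube, SpansGaps]
    omega
  · simp [Compat]
  · intro c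
    fin_cases c <;> simp [IsTube, SpansGaps] <;> omega
  · intro c c'
    fin_cases c <;> fin_cases c' <;> simp <;> omega
  · intro c
    fin_cases c <;> simp [Compat] <;> omega
  · rintro ⟨s, e⟩ h1 h2 h3 h4
    simp only [IsTube, SpansGaps, InTube, Finset.mem_insert, Finset.mem_singleton, Prod.mk.injEq,
      exists_eq_or_imp, exists_eq_left, forall_eq, Compat] at h1 h2 h3 h4
    have h5 : (s = i + 1 ∧ e = k) ∨ (s = 0 ∧ e = l) ∨ (s = j + 1 ∧ e = l) ∨
        (s = i + 1 ∧ e = m + 1) := by omega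
    rcases h5 with ⟨rfl, rfl⟩ | ⟨rfl, rfl⟩ | ⟨rfl, rfl⟩ | ⟨rfl, rfl⟩
    exacts [⟨0, rfl⟩, ⟨1, rfl⟩, ⟨2, rfl⟩, ⟨3, rfl⟩]
  · intro c c'
    fin_cases c <;> fin_cases c' <;> simp [Compat, CycleAdj] <;> omega
  · intro c
    fin_cases c <;> simp
  · intro c
    fin_cases c <;> simp [InTube] <;> omega
  · intro c
    fin_cases c <;> simp [InTube] <;> omega
  · intro c
    fin_cases c <;> simp [InTube] <;> omega

end Relations

/-! ### The inverse homomorphism and the isomorphism. -/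

section ToPicture

variable (K : Type u) [Field K] (m : ℕ)

/-- The generator of the picture group with index `[i, j)`. -/
noncomputable def pictureGenerator (p : StasheffGen (m + 1)) : PictureGroup K (LinearA m) :=
  PresentedGroup.of (rootEquiv m p)

variable {m}

theorem TubePolygon.prod_eq_one {d : ℕ} {R : Finset (ℕ × ℕ)} {I : Fin (d + 1) → ℕ × ℕ}
    {l : Fin (d + 1) → StasheffGen (m + 1) × Bool} (h : TubePolygon m d R I l)
    (hd : d = 3 ∨ d = 4) :
    ((List.range (d + 1)).map fun i => cond (l (Fin.ofNat (d + 1) i)).2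
      (pictureGenerator K m (l (Fin.ofNat (d + 1) i)).1)
      (pictureGenerator K m (l (Fin.ofNat (d + 1) i)).1)⁻¹).prod = 1 := by
  have h1 := PresentedGroup.one_of_mem (h.mem_pictureRels K hd)
  have h2 : PresentedGroup.mk (pictureRels K (LinearA m)) =
      FreeGroup.lift fun α => PresentedGroup.of α := by
    ext α
    simp [PresentedGroup.of]
  rw [h2, FreeGroup.lift_mk, List.map_map] at h1
  exact h1

theorem pictureGenerator_comm {i j k : ℕ} (hij : i < j) (hjk : j < k) (hk : k ≤ m) :
    pictureGenerator K m (stasheffIndex i j hij (by omega)) *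
      pictureGenerator K m (stasheffIndex j k hjk hk) =
    pictureGenerator K m (stasheffIndex j k hjk hk) *
      pictureGenerator K m (stasheffIndex i k (hij.trans hjk) hk) *
      pictureGenerator K m (stasheffIndex i j hij (by omega)) := by
  have h := (tubePolygon_pentagon hij hjk hk).prod_eq_one K (Or.inr rfl)
  simp [List.range_succ, Fin.ofNat] at h
  -- The pentagon reads x_ij⁻¹ x_ik⁻¹ x_jk⁻¹ x_ij x_jk = 1.
  rw [inv_mul_eq_one, eq_inv_mul_iff_mul_eq, eq_inv_mul_iff_mul_eq] at h
  rw [mul_assoc, h]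

theorem pictureGenerator_commute_disjoint {i j k l : ℕ} (hij : i < j) (hjk : j < k) (hkl : k < l)
    (hl : l ≤ m) : Commute (pictureGenerator K m (stasheffIndex i j hij (by omega)))
      (pictureGenerator K m (stasheffIndex k l hkl hl)) := by
  have h := (tubePolygon_disjoint hij hjk hkl hl).prod_eq_one K (Or.inl rfl)
  simp [List.range_succ, Fin.ofNat] at h
  rw [inv_mul_eq_one, eq_inv_mul_iff_mul_eq] at h
  exact h.symm

theorem pictureGenerator_commute_nested {i j k l : ℕ} (hij : i < j) (hjk : j < k) (hkl : k < l)
    (hl : l ≤ m) : Commute (pictureGenerator K m (stasheffIndex j k hjk (by omega)))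
      (pictureGenerator K m (stasheffIndex i l (hij.trans (hjk.trans hkl)) hl)) := by
  have h := (tubePolygon_nested hij hjk hkl hl).prod_eq_one K (Or.inl rfl)
  simp [List.range_succ, Fin.ofNat] at h
  rw [inv_mul_eq_one, eq_inv_mul_iff_mul_eq] at h
  exact h.symm

/-- Distinctness of the four endpoints makes the inequalities strict, which leaves exactly the
configurations of the two squares. -/
theorem noncrossing_cases {n : ℕ} {i j k l : Fin n} (hij : i < j) (hkl : k < l)
    (hdist : i ≠ k ∧ i ≠ l ∧ j ≠ k ∧ j ≠ l)
    (hint : Disjoint (openInterval i j) (openInterval k l) ∨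
      openInterval i j ⊆ openInterval k l ∨ openInterval k l ⊆ openInterval i j) :
    j < k ∨ l < i ∨ (k < i ∧ j < l) ∨ (i < k ∧ l < j) := by
  have hij' : ((i : ℕ) : ℝ) < (j : ℕ) := by exact_mod_cast hij
  have hkl' : ((k : ℕ) : ℝ) < (l : ℕ) := by exact_mod_cast hkl
  rcases hint with h | h | h
  · by_contra hcon
    have h1 : ((k : ℕ) : ℝ) < (j : ℕ) := by exact_mod_cast (show k < j by omega)
    have h2 : ((i : ℕ) : ℝ) < (l : ℕ) := by exact_mod_cast (show i < l by omega)
    have h3 : max ((i : ℕ) : ℝ) (k : ℕ) < min ((j : ℕ) : ℝ) (l : ℕ) := by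
      simp [hij, hkl, h1, h2]
    obtain ⟨y, hy1, hy2⟩ := exists_between h3
    rw [max_lt_iff] at hy1
    rw [lt_min_iff] at hy2
    exact Set.disjoint_left.1 h ⟨hy1.1, hy2.1⟩ ⟨hy1.2, hy2.2⟩
  · have := (Set.Ioo_subset_Ioo_iff hij').1 h
    have h1 : k ≤ i := by exact_mod_cast this.1
    have h2 : j ≤ l := by exact_mod_cast this.2
    omega
  · have := (Set.Ioo_subset_Ioo_iff hkl').1 h
    have h1 : i ≤ k := by exact_mod_cast this.1
    have h2 : l ≤ j := by exact_mod_cast this.2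
    omega

theorem lift_stasheffRel {r : FreeGroup (StasheffGen (m + 1))} (hr : StasheffRel (m + 1) r) :
    FreeGroup.lift (pictureGenerator K m) r = 1 := by
  cases hr with
  | comm i j k hij hjk =>
    rw [map_mul, map_inv, map_stasheffComm, stasheffComm_mul_inv_eq_one_iff]
    simp only [stasheffX, FreeGroup.lift_apply_of]
    exact pictureGenerator_comm K hij hjk (Nat.lt_succ_iff.1 k.2)
  | commute i j k l hij hkl hdist hint =>
    rw [map_stasheffComm, stasheffComm_eq_one_iff]
    simp only [stasheffX, FreeGroup.lift_apply_of]
    rcases noncrossing_cases hij hkl hdist hint with h | h | ⟨h, h'⟩ | ⟨h, h'⟩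
    · exact pictureGenerator_commute_disjoint K hij h hkl (Nat.lt_succ_iff.1 l.2)
    · exact (pictureGenerator_commute_disjoint K hkl h hij (Nat.lt_succ_iff.1 j.2)).symm
    · exact pictureGenerator_commute_nested K h hij h' (Nat.lt_succ_iff.1 l.2)
    · exact (pictureGenerator_commute_nested K h hkl h' (Nat.lt_succ_iff.1 j.2)).symm

variable (m) in
/-- The homomorphism from the Stasheff group to the picture group. -/
noncomputable def stasheffToPicture : StasheffGroup (m + 1) →* PictureGroup K (LinearA m) :=
  PresentedGroup.toGroup (f := pictureGenerator K m) fun _ hr => lift_stasheffRel K hr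

variable (m) in
/-- The Stasheff group is isomorphic to the picture group of the linear quiver. -/
noncomputable def stasheffEquivPicture : StasheffGroup (m + 1) ≃* PictureGroup K (LinearA m) :=
  MonoidHom.toMulEquiv (stasheffToPicture K m) (pictureToStasheff K m)
    (by
      apply PresentedGroup.ext
      intro p
      rw [MonoidHom.comp_apply, stasheffToPicture, PresentedGroup.toGroup.of]
      exact pictureToStasheff_of K m p)
    (by
      apply PresentedGroup.ext
      intro α
      obtain ⟨p, rfl⟩ := (rootEquiv m).surjective α
      rw [MonoidHom.comp_apply, pictureToStasheff_of, stasheffToPicture,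
        PresentedGroup.toGroup.of]
      rfl)

end ToPicture

theorem mainTheorem7 (K : Type u) [Field K] (n : ℕ) (hn : 1 ≤ n) :
    Nonempty (StasheffGroup n ≃* PictureGroup K (LinearA (n - 1))) := by
  obtain ⟨m, rfl⟩ := Nat.exists_eq_add_of_le' hn
  exact ⟨stasheffEquivPicture K m⟩
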